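/- **Automata with timers.** An automaton with timers $\mathcal A=(X,I,Q,q_0,\chi,\delta)$ has finite sets $X$ of timers, $I$ of inputs, $Q\ni q_0$ of states, active timers $\chi:Q\to 2^X$ with $\chi(q_0)=\emptyset$, and a partial function $\delta:Q\times\hat I\to Q\times U$, where $\hat I=I\cup\{\mathrm{to}[x]\mid x\in X\}$ is the set of actions and $U=(X\times\mathbb N^{>0})\cup\{\bot\}$ the set of updates. Here $\delta(q,i)$ is defined iff $i\in I$ or $i=\mathrm{to}[x]$ with $x\in\chi(q)$. If $\delta(q,i)=(q',\bot)$, then $\chi(q')\subseteq\chi(q)$, and $x\notin\chi(q')$ if $i=\mathrm{to}[x]$; if $\delta(q,i)=(q',(x,c))$, then $x\in\chi(q')$ and $\chi(q')\setminus\{x\}\subseteq\chi(q)$, and $y=x$ if $i=\mathrm{to}[y]$. This transition *discards* $x$ if $x\in\chi(q)$, $i\ne\mathrm{to}[x]$, and $x\notin\chi(q')$ or the update is $(x,c)$ for some $c$. A configuration is a state $q$ with a valuation $\kappa:\chi(q)\to\mathbb R^{\ge0}$. A delay $d\ge0$ may elapse if all values are $\ge d$, and decreases all values by $d$; a discrete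 transition follows $\delta$, sets $x$ to $c$ if the update is $(x,c)$, keeps the values of the other timers active in $q'$, and requires $\kappa(x)=0$ if its action is $\mathrm{to}[x]$. A timed run $\rho=(q_0,\emptyset)\,d_1\,i_1/u_1\cdots d_n\,i_n/u_n\,d_{n+1}\,(q,\kappa)$ alternates delays and discrete transitions. It is *padded* if $d_1,d_{n+1}>0$ and no timer has value $0$ in $\kappa$. Its untimed trace is the alternating sequence of its states and actions. **Blocks, races, wiggling.** For $k<k'$, $i_k$ triggers $i_{k'}$ if for some $x$, $u_k=(x,c)$, $i_{k'}=\mathrm{to}[x]$, and no action strictly in between is $\mathrm{to}[x]$ or discards $x$. A *block* of a padded run is a maximal sequence $k_1\dots k_m$ such that $i_{k_1}\in I$ and each $i_{k_\ell}$ triggers $i_{k_{\ell+1}}$, with a fate: $\bot$ if $i_{k_m}$ starts no timer; $\bullet$ if $i_{k_m}$ starts a timer $x$ and the first later action that discards $x$ does so when its value is $0$; $\times$ otherwise. Two distinct blocks $B,B'$ *participate in a race* if, possibly after exchanging them, either the sum of the delays between some action of $B$ and some action of $B'$ is $0$, or $B'$ has fate $\bullet$ and the first action that discards the timer started by the last action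 of $B'$ belongs to $B$. *Wiggling* a block $B$ that participates in a race means passing from $\rho$ to a padded timed run $\rho'$ with the same untimed trace, in which for some real $\varepsilon\ne0$ all actions of $B$ occur $\varepsilon$ later (earlier if $\varepsilon<0$) while the times of the other actions and the total duration are unchanged, and in which $B$ participates in no race. A padded timed run *can be wiggled* if a finite sequence (possibly empty) of such steps leads to a run without races. **Modified region automaton $\mathcal R$.** Two configurations are equivalent if they have the same state, all timers have the same integer part, the same timers have fractional part $0$, and the fractional parts are ordered in the same way. The states of $\mathcal R$ are pairs $(r,D)$ of an equivalence class $r$ of configurations and a set $D\subseteq X$, the initial state is $([(q_0,\emptyset)],\emptyset)$, and the alphabet is $\Sigma=\{\tau\}\cup(\hat I\times(X\cup\{\bot\}))\cup\{\bot[x]\mid x\in X\}$. There are transitions $([c],\emptyset)\xrightarrow{\tau}([c'],\emptyset)$ for each delay transition from $c$ to $c'$ of nonzero duration; $([c],\emptyset)\xrightarrow{(i,y)}([c'],D)$ for each discrete transition from $c$ to $c'$ with action $i$, where $y$ is the updated timer ($\bot$ if there is none) and $D$ is the set of timers that it discards and that have value $0$ in $c$; and $(r,D)\xrightarrow{\bot[x]}(r,D\setminus\{x\})$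 for $x\in D$. Runs of $\mathcal R$ start in the initial state. A run of $\mathcal R$ whose last state has $D=\emptyset$ *corresponds* to a timed run of $\mathcal A$ if it is obtained from it by passing to equivalence classes, reading every nonzero delay as one or several $\tau$, omitting zero delays, and reading the symbols $\bot[x]$ of the discarded zero-valued timers right after the action that discards them. A run of $\mathcal R$ is *padded* if it corresponds to a padded timed run, and *can be wiggled* if it corresponds to a padded timed run that can be wiggled. **Statement.** There is an absolute constant $C$ such that for all finite sets $X$ and $I$ there is an MSO sentence $\Phi$ over words on $\Sigma$ (signature $<,(Q_a)_{a\in\Sigma}$, with equality; first-order variables range over positions and set variables over sets of positions) with at most $C\,(|I|+1)(|X|+1)$ atoms, connectives and quantifiers, which is in prenex normal form with exactly three quantifier alternations, such that for every automaton with timers $\mathcal A$ with timers $X$ and inputs $I$, with modified region automaton $\mathcal R$: 1. for every word $w$ that labels a run of $\mathcal R$, $w\models\Phi$ iff $w$ labels a padded run of $\mathcal R$ that cannot be wiggled; 2. for every run $r$ of $\mathcal R$ in whose last state no timer has value $0$, with label $w$: $w\models\Phi$ iff $r$ is padded and cannot be wiggled. -/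

import Mathlib

/-! ### Automata with timers and their timed semantics -/

/-- Actions: reading an input, or processing the timeout of a timer. -/
inductive TAction (X I : Type*) where
  | input (i : I) : TAction X I
  | timeout (x : X) : TAction X I

/-- Updates: `none` for no update, `some (x, c)` for (re)starting the timer `x` with value `c > 0`. -/
abbrev TUpdate (X : Type*) := Option (X × ℕ+)

/-- Automata with timers, with timers `X`, inputs `I` and states `Q`. The transition function is
partial; `none` means undefined. -/
structure TimerAutomaton (X I Q : Type*) where
  init : Q
  active : Q → Set X
  active_init : active init = ∅
  trans : Q → TAction X I → Option (Q × TUpdate X)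
  trans_defined : ∀ q a, (trans q a).isSome ↔
    (∃ i, a = TAction.input i) ∨ ∃ x ∈ active q, a = TAction.timeout x
  timeout_update : ∀ q x q' y c,
    trans q (TAction.timeout x) = some (q', some (y, c)) → y = x
  active_of_no_update : ∀ q a q', trans q a = some (q', none) → active q' ⊆ active q
  timeout_no_update : ∀ q x q',
    trans q (TAction.timeout x) = some (q', none) → x ∉ active q'
  active_of_update : ∀ q a q' x c, trans q a = some (q', some (x, c)) →
    x ∈ active q' ∧ active q' \ {x} ⊆ active q

namespace TimerAutomaton

variable {X I Q : Type*}

/-- Configurations: a state with a valuation, i.e. a partial function from timers to nonnegative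
reals whose domain is the set of active timers of the state. -/
structure Config (A : TimerAutomaton X I Q) where
  state : Q
  val : X → Option ℝ
  dom : ∀ x, (val x).isSome ↔ x ∈ A.active state
  nonneg : ∀ x v, val x = some v → 0 ≤ v

variable {A : TimerAutomaton X I Q}

/-- The initial configuration, with the empty valuation. -/
def initConfig (A : TimerAutomaton X I Q) : Config A where
  state := A.init
  val := fun _ => none
  dom := by simp [A.active_init]
  nonneg := by simp

/-- Delay transition of duration `d ≥ 0` (all active timers have value at least `d`). -/
def Delay (c : Config A) (d : ℝ) (c' : Config A) : Prop :=
  0 ≤ d ∧ c'.state = c.state ∧ (∀ x v, c.val x = some v → d ≤ v) ∧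
    ∀ x, c'.val x = (c.val x).map (fun v => v - d)

/-- Discrete transition with action `a` and update `u`. -/
def Step (c : Config A) (a : TAction X I) (u : TUpdate X) (c' : Config A) : Prop :=
  A.trans c.state a = some (c'.state, u) ∧
  (∀ x, a = TAction.timeout x → c.val x = some 0) ∧
  ∀ y ∈ A.active c'.state,
    (∀ n : ℕ+, u = some (y, n) → c'.val y = some ((n : ℕ) : ℝ)) ∧
    ((∀ n : ℕ+, u ≠ some (y, n)) → c'.val y = c.val y)

/-- A transition from state `q` to state `q'` with action `a` and update `u` discards the timer `x`:
`x` is active in `q`, the action is not its timeout, and the transition stops or restarts `x`. -/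
def Discards (A : TimerAutomaton X I Q) (q : Q) (a : TAction X I) (u : TUpdate X) (q' : Q)
    (x : X) : Prop :=
  x ∈ A.active q ∧ a ≠ TAction.timeout x ∧ (x ∉ A.active q' ∨ ∃ n : ℕ+, u = some (x, n))

/-- Timed runs with `n` actions. The action `k : Fin n` takes place between the delays
`k.castSucc` and `k.succ`; `pre j` and `post j` are the configurations before and after the
delay `j`. -/
structure TimedRun (A : TimerAutomaton X I Q) (n : ℕ) where
  pre : Fin (n + 1) → Config A
  delay : Fin (n + 1) → ℝ
  post : Fin (n + 1) → Config A
  act : Fin n → TAction X I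
  upd : Fin n → TUpdate X
  pre_zero : pre 0 = A.initConfig
  delay_step : ∀ j, Delay (pre j) (delay j) (post j)
  act_step : ∀ k : Fin n, Step (post k.castSucc) (act k) (upd k) (pre k.succ)

/-- Timer fates of blocks. -/
inductive Fate where
  /-- the last action of the block does not restart the timer -/
  | bot
  /-- the timer is later discarded when its value is zero -/
  | newMoon
  /-- all other cases -/
  | cross

namespace TimedRun

variable {n : ℕ}

/-- First and last delays are nonzero and no timer is zero in the last configuration. -/
def Padded (ρ : TimedRun A n) : Prop :=
  0 < ρ.delay 0 ∧ 0 < ρ.delay (Fin.last n) ∧ ∀ x, (ρ.post (Fin.last n)).val x ≠ some 0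

/-- Equality of untimed traces (the alternating sequences of states and actions). -/
def SameUntimed (ρ ρ' : TimedRun A n) : Prop :=
  (∀ j, (ρ.pre j).state = (ρ'.pre j).state) ∧ ∀ k, ρ.act k = ρ'.act k

/-- The `k`-th action discards the timer `x`. -/
def DiscardsAt (ρ : TimedRun A n) (k : Fin n) (x : X) : Prop :=
  A.Discards (ρ.post k.castSucc).state (ρ.act k) (ρ.upd k) (ρ.pre k.succ).state x

/-- The action `k` triggers the action `k'`. -/
def Triggers (ρ : TimedRun A n) (k k' : Fin n) : Prop :=
  k < k' ∧ ∃ x, (∃ c : ℕ+, ρ.upd k = some (x, c)) ∧ ρ.act k' = TAction.timeout x ∧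
    ∀ l, k < l → l < k' → ρ.act l ≠ TAction.timeout x ∧ ¬ ρ.DiscardsAt l x

/-- Sequences of actions that start with an input and in which each action triggers the next. -/
def IsTriggerSeq (ρ : TimedRun A n) (L : List (Fin n)) : Prop :=
  (∃ k i, L.head? = some k ∧ ρ.act k = TAction.input i) ∧ L.IsChain ρ.Triggers

/-- The action `k` (re)starts the timer `x`, and `l` is the first later action that discards it. -/
def FirstDiscard (ρ : TimedRun A n) (k l : Fin n) (x : X) : Prop :=
  (∃ c : ℕ+, ρ.upd k = some (x, c)) ∧ k < l ∧ ρ.DiscardsAt l x ∧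
    ∀ j, k < j → j < l → ¬ ρ.DiscardsAt j x

open Classical in
/-- The timer fate of a block whose last action is `k`. -/
noncomputable def timerFate (ρ : TimedRun A n) (k : Fin n) : Fate :=
  if ρ.upd k = none then Fate.bot
  else if ∃ l x, ρ.FirstDiscard k l x ∧ (ρ.post l.castSucc).val x = some 0 then Fate.newMoon
  else Fate.cross

/-- Blocks: a maximal trigger sequence of action indices together with its timer fate. -/
structure Block (ρ : TimedRun A n) where
  seq : List (Fin n)
  fate : Fate
  isTriggerSeq : ρ.IsTriggerSeq seq
  maximal : ∀ L, ρ.IsTriggerSeq L → seq.Sublist L → L = seq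
  fate_eq : ∃ k, seq.getLast? = some k ∧ fate = ρ.timerFate k

/-- The sum of the delays between the actions `k` and `k'`. -/
noncomputable def elapsed (ρ : TimedRun A n) (k k' : Fin n) : ℝ :=
  ∑ j with (min k k').castSucc < j ∧ j ≤ (max k k').castSucc, ρ.delay j

/-- The two cases in which `B` and `B'` participate in a race; the second case is not symmetric. -/
def RaceCase {ρ : TimedRun A n} (B B' : Block ρ) : Prop :=
  (∃ k ∈ B.seq, ∃ k' ∈ B'.seq, ρ.elapsed k k' = 0) ∨
  (B'.fate = Fate.newMoon ∧
    ∃ k ∈ B.seq, ∃ k' x, B'.seq.getLast? = some k' ∧ ρ.FirstDiscard k' k x)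

/-- The two distinct blocks `B` and `B'` participate in a race. -/
def Race {ρ : TimedRun A n} (B B' : Block ρ) : Prop :=
  B ≠ B' ∧ (RaceCase B B' ∨ RaceCase B' B)

/-- The block `B` participates in some race. -/
def InRace {ρ : TimedRun A n} (B : Block ρ) : Prop := ∃ B', Race B B'

/-- The run has no races. -/
def RaceFree (ρ : TimedRun A n) : Prop := ∀ B B' : Block ρ, ¬ Race B B'

open Classical in
/-- Change of the delay `j` when the actions in `L` are moved by `ε` and all others stay in place:
`+ ε` when the next action moves and the previous one does not, `- ε` when the previous action
moves and the next one does not, and no change otherwise. -/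
noncomputable def delayShift (L : List (Fin n)) (ε : ℝ) (j : Fin (n + 1)) : ℝ :=
  (if ∃ k ∈ L, k.castSucc = j then ε else 0) - (if ∃ k ∈ L, k.succ = j then ε else 0)

/-- `ρ'` is obtained from `ρ` by wiggling one block of `ρ` that participates in a race: the block is
moved to the left (`ε < 0`) or to the right (`ε > 0`), and then participates in no race. -/
def WiggleBlock (ρ ρ' : TimedRun A n) : Prop :=
  ρ.Padded ∧ ρ'.Padded ∧ SameUntimed ρ ρ' ∧
  ∃ B : Block ρ, InRace B ∧
    (∃ ε : ℝ, ε ≠ 0 ∧ ∀ j, ρ'.delay j = ρ.delay j + delayShift B.seq ε j) ∧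
    ∀ B' : Block ρ', B'.seq = B.seq → ¬ InRace B'

/-- A padded run can be wiggled if wiggling its blocks one at a time leads to a run without races. -/
def Wigglable (ρ : TimedRun A n) : Prop :=
  ρ.Padded ∧ ∃ ρ' : TimedRun A n, Relation.ReflTransGen WiggleBlock ρ ρ' ∧ RaceFree ρ'

end TimedRun

/-! ### The modified region automaton -/

/-- Timer-equivalence of configurations. -/
def RegionEquiv (c c' : Config A) : Prop :=
  c.state = c'.state ∧
  (∀ x v v', c.val x = some v → c'.val x = some v' →
    ⌊v⌋ = ⌊v'⌋ ∧ (Int.fract v = 0 ↔ Int.fract v' = 0)) ∧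
  (∀ x y v v' w w', c.val x = some v → c'.val x = some v' → c.val y = some w →
    c'.val y = some w' →
    (Int.fract v ≤ Int.fract w ↔ Int.fract v' ≤ Int.fract w'))

theorem Config.exists_val {c c' : Config A} (h : c.state = c'.state) {x : X} {v : ℝ}
    (hv : c.val x = some v) : ∃ v', c'.val x = some v' := by
  have h1 : x ∈ A.active c.state := (c.dom x).1 (by simp [hv])
  exact Option.isSome_iff_exists.1 ((c'.dom x).2 (h ▸ h1))

instance regionSetoid (A : TimerAutomaton X I Q) : Setoid (Config A) where
  r := RegionEquiv
  iseqv :=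
    { refl := fun c => by
        refine ⟨rfl, ?_, ?_⟩
        · intro x v v' h h'
          obtain rfl : v = v' := Option.some.inj (h.symm.trans h')
          exact ⟨rfl, Iff.rfl⟩
        · intro x y v v' w w' h h' g g'
          obtain rfl : v = v' := Option.some.inj (h.symm.trans h')
          obtain rfl : w = w' := Option.some.inj (g.symm.trans g')
          exact Iff.rfl
      symm := fun {c c'} h => by
        refine ⟨h.1.symm, ?_, ?_⟩
        · intro x v v' h1 h2
          exact ⟨(h.2.1 x v' v h2 h1).1.symm, (h.2.1 x v' v h2 h1).2.symm⟩
        · intro x y v v' w w' h1 h2 g1 g2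
          exact (h.2.2 x y v' v w' w h2 h1 g2 g1).symm
      trans := fun {c c' c''} h h' => by
        refine ⟨h.1.trans h'.1, ?_, ?_⟩
        · intro x v v'' h1 h2
          obtain ⟨v', hv'⟩ := Config.exists_val h.1 h1
          have e1 := h.2.1 x v v' h1 hv'
          have e2 := h'.2.1 x v' v'' hv' h2
          exact ⟨e1.1.trans e2.1, e1.2.trans e2.2⟩
        · intro x y v v'' w w'' h1 h2 g1 g2
          obtain ⟨v', hv'⟩ := Config.exists_val h.1 h1
          obtain ⟨w', hw'⟩ := Config.exists_val h.1 g1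
          exact (h.2.2 x y v v' w w' h1 hv' g1 hw').trans
            (h'.2.2 x y v' v'' w' w'' hv' h2 hw' g2) }

end TimerAutomaton

/-- The alphabet of the modified region automaton: `tau` for nonzero delays, an action with the
timer it updates (`none` if it updates no timer), and symbols `kill x` for the timers that have just
been discarded while their value was zero. -/
inductive RegionLetter (X I : Type*) where
  | tau : RegionLetter X I
  | act (a : TAction X I) (x : Option X) : RegionLetter X I
  | kill (x : X) : RegionLetter X I

namespace TimerAutomaton

variable {X I Q : Type*} {A : TimerAutomaton X I Q}

/-- States of the modified region automaton: a class of configurations, and the set of timers that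
have been discarded at value zero and not yet been reported by a `kill` symbol. -/
structure RegionState (A : TimerAutomaton X I Q) where
  region : Quotient (regionSetoid A)
  pending : Set X

/-- The initial state of the modified region automaton. -/
def initRegionState (A : TimerAutomaton X I Q) : RegionState A :=
  ⟨Quotient.mk _ A.initConfig, ∅⟩

/-- Transitions of the modified region automaton. Delays and actions are possible only when no
discarded timer is pending. -/
def RegionStep (s : RegionState A) : RegionLetter X I → RegionState A → Prop
  | RegionLetter.tau, s' =>
      s.pending = ∅ ∧ s'.pending = ∅ ∧ ∃ (c c' : Config A) (d : ℝ),
        s.region = Quotient.mk _ c ∧ s'.region = Quotient.mk _ c' ∧ 0 < d ∧ Delay c d c'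
  | RegionLetter.act a x, s' =>
      s.pending = ∅ ∧ ∃ (c c' : Config A) (u : TUpdate X),
        s.region = Quotient.mk _ c ∧ s'.region = Quotient.mk _ c' ∧ Step c a u c' ∧
        x = u.map Prod.fst ∧
        s'.pending = {y | A.Discards c.state a u c'.state y ∧ c.val y = some 0}
  | RegionLetter.kill x, s' =>
      x ∈ s.pending ∧ s'.region = s.region ∧ s'.pending = s.pending \ {x}

/-- Runs of the modified region automaton that are labelled by the word `w`. -/
structure RegionRun (A : TimerAutomaton X I Q) {m : ℕ} (w : Fin m → RegionLetter X I) where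
  state : Fin (m + 1) → RegionState A
  state_zero : state 0 = A.initRegionState
  step : ∀ j : Fin m, RegionStep (state j.castSucc) (w j) (state j.succ)

namespace RegionRun

variable {m n : ℕ} {w : Fin m → RegionLetter X I}

/-- The run `r` of the modified region automaton corresponds to the timed run `ρ`. After `j` letters
of `r`, the timed run has executed `pos j` actions and then waited for `wait j` time units. Zero
delays are not visible, and a nonzero delay is read as one or several `tau`. -/
def Represents (r : RegionRun A w) (ρ : TimedRun A n) : Prop :=
  ∃ (pos : Fin (m + 1) → Fin (n + 1)) (wait : Fin (m + 1) → ℝ),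
    pos 0 = 0 ∧ wait 0 = 0 ∧
    (∀ j, ∃ c, Delay (ρ.pre (pos j)) (wait j) c ∧ (r.state j).region = Quotient.mk _ c) ∧
    (∀ j : Fin m, w j = RegionLetter.tau →
      pos j.succ = pos j.castSucc ∧ wait j.castSucc < wait j.succ) ∧
    (∀ (j : Fin m) (a : TAction X I) (x : Option X), w j = RegionLetter.act a x →
      ∃ k : Fin n, pos j.castSucc = k.castSucc ∧ pos j.succ = k.succ ∧ ρ.act k = a ∧
        wait j.castSucc = ρ.delay k.castSucc ∧ wait j.succ = 0) ∧
    (∀ (j : Fin m) (x : X), w j = RegionLetter.kill x →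
      pos j.succ = pos j.castSucc ∧ wait j.succ = wait j.castSucc) ∧
    pos (Fin.last m) = Fin.last n ∧ wait (Fin.last m) = ρ.delay (Fin.last n) ∧
    (r.state (Fin.last m)).pending = ∅

/-- The run corresponds to a padded timed run. -/
def Padded (r : RegionRun A w) : Prop :=
  ∃ (n : ℕ) (ρ : TimedRun A n), r.Represents ρ ∧ ρ.Padded

/-- The run corresponds to a timed run that can be wiggled. -/
def Wigglable (r : RegionRun A w) : Prop :=
  ∃ (n : ℕ) (ρ : TimedRun A n), r.Represents ρ ∧ ρ.Wigglable

/-- No timer has value zero in the last state of the run. -/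
def NoZeroAtEnd (r : RegionRun A w) : Prop :=
  ∀ c : Config A, (r.state (Fin.last m)).region = Quotient.mk _ c → ∀ x, c.val x ≠ some 0

end RegionRun

end TimerAutomaton

/-! ### Monadic second-order logic over words -/

/-- MSO formulas over the signature `<`, `(Q_a)` with `k` free position variables and `l` free set
variables. A quantifier binds the variable with index `0`. -/
inductive MSO (S : Type*) : ℕ → ℕ → Type _ where
  | letter {k l : ℕ} (a : S) (p : Fin k) : MSO S k l
  | lt {k l : ℕ} (p q : Fin k) : MSO S k l
  | eq {k l : ℕ} (p q : Fin k) : MSO S k l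
  | mem {k l : ℕ} (p : Fin k) (P : Fin l) : MSO S k l
  | not {k l : ℕ} (f : MSO S k l) : MSO S k l
  | and {k l : ℕ} (f g : MSO S k l) : MSO S k l
  | or {k l : ℕ} (f g : MSO S k l) : MSO S k l
  | imp {k l : ℕ} (f g : MSO S k l) : MSO S k l
  | exPos {k l : ℕ} (f : MSO S (k + 1) l) : MSO S k l
  | allPos {k l : ℕ} (f : MSO S (k + 1) l) : MSO S k l
  | exSet {k l : ℕ} (f : MSO S k (l + 1)) : MSO S k l
  | allSet {k l : ℕ} (f : MSO S k (l + 1)) : MSO S k l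

/-- The two kinds of quantifiers. -/
inductive QuantKind where
  | ex
  | all
  deriving DecidableEq

/-- The number of alternations between existential and universal quantifiers in a list. -/
def alternationCount : List QuantKind → ℕ
  | a :: b :: t => (if a = b then 0 else 1) + alternationCount (b :: t)
  | _ => 0

namespace MSO

variable {S : Type*}

/-- Satisfaction in the word structure of `w : Fin m → S`. -/
def Sat {m : ℕ} (w : Fin m → S) :
    {k l : ℕ} → MSO S k l → (Fin k → Fin m) → (Fin l → Set (Fin m)) → Prop
  | _, _, letter a p, v, _ => w (v p) = a
  | _, _, lt p q, v, _ => v p < v q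
  | _, _, eq p q, v, _ => v p = v q
  | _, _, mem p P, v, V => v p ∈ V P
  | _, _, not f, v, V => ¬ Sat w f v V
  | _, _, and f g, v, V => Sat w f v V ∧ Sat w g v V
  | _, _, or f g, v, V => Sat w f v V ∨ Sat w g v V
  | _, _, imp f g, v, V => Sat w f v V → Sat w g v V
  | _, _, exPos f, v, V => ∃ p : Fin m, Sat w f (Fin.cons p v) V
  | _, _, allPos f, v, V => ∀ p : Fin m, Sat w f (Fin.cons p v) V
  | _, _, exSet f, v, V => ∃ P : Set (Fin m), Sat w f v (Fin.cons P V)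
  | _, _, allSet f, v, V => ∀ P : Set (Fin m), Sat w f v (Fin.cons P V)

/-- The word `w` satisfies the sentence `f`. -/
def Models {m : ℕ} (w : Fin m → S) (f : MSO S 0 0) : Prop :=
  Sat w f Fin.elim0 Fin.elim0

/-- The size of a formula: the number of its atoms, connectives and quantifiers. -/
def size : {k l : ℕ} → MSO S k l → ℕ
  | _, _, letter _ _ => 1
  | _, _, lt _ _ => 1
  | _, _, eq _ _ => 1
  | _, _, mem _ _ => 1
  | _, _, not f => size f + 1
  | _, _, and f g => size f + size g + 1
  | _, _, or f g => size f + size g + 1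
  | _, _, imp f g => size f + size g + 1
  | _, _, exPos f => size f + 1
  | _, _, allPos f => size f + 1
  | _, _, exSet f => size f + 1
  | _, _, allSet f => size f + 1

/-- The formula has no quantifiers. -/
def QuantFree : {k l : ℕ} → MSO S k l → Prop
  | _, _, letter _ _ => True
  | _, _, lt _ _ => True
  | _, _, eq _ _ => True
  | _, _, mem _ _ => True
  | _, _, not f => QuantFree f
  | _, _, and f g => QuantFree f ∧ QuantFree g
  | _, _, or f g => QuantFree f ∧ QuantFree g
  | _, _, imp f g => QuantFree f ∧ QuantFree g
  | _, _, exPos _ => False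
  | _, _, allPos _ => False
  | _, _, exSet _ => False
  | _, _, allSet _ => False

/-- Prenex normal form: a sequence of quantifiers followed by a quantifier-free formula. -/
def IsPrenex : {k l : ℕ} → MSO S k l → Prop
  | _, _, exPos f => IsPrenex f
  | _, _, allPos f => IsPrenex f
  | _, _, exSet f => IsPrenex f
  | _, _, allSet f => IsPrenex f
  | _, _, f => QuantFree f

/-- The sequence of the leading quantifiers of a formula. -/
def quantPrefix : {k l : ℕ} → MSO S k l → List QuantKind
  | _, _, exPos f => QuantKind.ex :: quantPrefix f
  | _, _, allPos f => QuantKind.all :: quantPrefix f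
  | _, _, exSet f => QuantKind.ex :: quantPrefix f
  | _, _, allSet f => QuantKind.all :: quantPrefix f
  | _, _, _ => []

end MSO

/-! Races form a directed graph. Blocks partition the actions, and an `Edge` from p to q says that q
follows p at the same instant, or that p discards at value zero the timer started by q. In both
cases a quantity that must stay nonnegative is already zero, and it would decrease if p moved later
relative to q. So a block can move right only if no edge leaves it, and left only if no edge enters
it.

A padded run can be wiggled iff this graph, read on blocks, is acyclic. A wiggled block is a sink or
a source of the graph, so a cycle survives every wiggle (`WiggleBlock.cyclic`), while a race-free
run has no edges. Conversely, a finite acyclic graph with an edge has a block that edges enter but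
none leaves. Moving it slightly to the right destroys all its edges and creates none
(`exists_wiggleBlock`), and induction on the number of edges concludes (`wigglable_of_not_cyclic`).

The graph can be read off the label. Region equivalence is a bisimulation, so every region run
follows a timed run (`exists_tracks`). Two actions are simultaneous iff no `tau` separates them, a
timeout is triggered by the most recent update of its timer, and discards at zero are announced by
`kill` letters (`Tracks.triggers_iff`, `Tracks.edge_iff`). Hence all timed runs represented by
region runs with one label agree on cyclicity.

A cycle is witnessed by a set of actions whose blocks all have edges back into the set. Moving
inside a block is a transitive closure of triggering. To avoid it, the set is split into actions E
with an edge of their own, L that reach E by triggering, and R that are reached from E. Each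
condition then concerns one neighbour, which gives the prefix ∃∀∃∀. The formula also requires the
first and last letters to be `tau`. It cannot see whether a timer is zero at the end: this is
assumed in the second claim, and arranged in the first by halving the last delay
(`exists_noZeroAtEnd`). -/

namespace TimerAutomaton

variable {X I Q : Type*} {A : TimerAutomaton X I Q}

/-! ### Absolute times, last updates and triggering -/

namespace TimedRun

variable {n : ℕ}

/-- The absolute time at which the delay `j` ends, i.e. the time of the action following it. -/
noncomputable def time (ρ : TimedRun A n) (j : Fin (n + 1)) : ℝ := ∑ i ∈ Finset.Iic j, ρ.delay i

theorem sum_Iic_zero (f : Fin (n + 1) → ℝ) : ∑ i ∈ Finset.Iic 0, f i = f 0 := by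
  have : (Finset.Iic (0 : Fin (n + 1))) = {0} := by
    ext i; simp
  rw [this, Finset.sum_singleton]

theorem sum_Iic_succ (f : Fin (n + 1) → ℝ) (k : Fin n) :
    ∑ i ∈ Finset.Iic k.succ, f i = (∑ i ∈ Finset.Iic k.castSucc, f i) + f k.succ := by
  have : (Finset.Iic k.succ) = insert k.succ (Finset.Iic k.castSucc) := by
    ext i
    simp only [Finset.mem_Iic, Finset.mem_insert, Fin.le_def, Fin.ext_iff, Fin.val_succ,
      Fin.val_castSucc]
    omega
  rw [this, Finset.sum_insert, add_comm]
  simp [Fin.le_def]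

theorem time_succ (ρ : TimedRun A n) (k : Fin n) :
    ρ.time k.succ = ρ.time k.castSucc + ρ.delay k.succ := sum_Iic_succ _ _

theorem delay_nonneg (ρ : TimedRun A n) (j : Fin (n + 1)) : 0 ≤ ρ.delay j := (ρ.delay_step j).1

theorem time_mono (ρ : TimedRun A n) : Monotone ρ.time := fun _ _ h =>
  Finset.sum_le_sum_of_subset_of_nonneg (Finset.Iic_subset_Iic.2 h)
    fun i _ _ => ρ.delay_nonneg i

theorem post_state (ρ : TimedRun A n) (j : Fin (n + 1)) :
    (ρ.post j).state = (ρ.pre j).state := (ρ.delay_step j).2.1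

theorem trans_eq (ρ : TimedRun A n) (k : Fin n) :
    A.trans (ρ.pre k.castSucc).state (ρ.act k) = some ((ρ.pre k.succ).state, ρ.upd k) :=
  ρ.post_state k.castSucc ▸ (ρ.act_step k).1

theorem elapsed_of_le (ρ : TimedRun A n) {k k' : Fin n} (h : k ≤ k') :
    ρ.elapsed k k' = ρ.time k'.castSucc - ρ.time k.castSucc := by
  have hs : Finset.Iic k.castSucc ⊆ Finset.Iic k'.castSucc :=
    Finset.Iic_subset_Iic.2 (Fin.castSucc_le_castSucc_iff.2 h)
  have := Finset.sum_sdiff (f := ρ.delay) hs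
  have e : (Finset.univ.filter fun j : Fin (n + 1) =>
      (min k k').castSucc < j ∧ j ≤ (max k k').castSucc) =
      Finset.Iic k'.castSucc \ Finset.Iic k.castSucc := by
    ext j
    simp [min_eq_left h, max_eq_right h, and_comm]
  rw [elapsed, e, time, time]
  linarith

theorem elapsed_comm (ρ : TimedRun A n) (k k' : Fin n) : ρ.elapsed k k' = ρ.elapsed k' k := by
  rw [elapsed, elapsed, min_comm, max_comm]

/-- Elapsed time telescopes to a difference of absolute times, so races of the first kind are
simultaneities. -/
theorem elapsed_eq_zero (ρ : TimedRun A n) {k k' : Fin n} :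
    ρ.elapsed k k' = 0 ↔ ρ.time k.castSucc = ρ.time k'.castSucc := by
  rcases le_total k k' with h | h
  · rw [elapsed_of_le ρ h, sub_eq_zero, eq_comm]
  · rw [elapsed_comm, elapsed_of_le ρ h, sub_eq_zero]

/-- `k` is the last action before the configuration `j` that (re)starts the timer `x`, and it sets
`x` to `c`. -/
def LastUpdate (ρ : TimedRun A n) (j : Fin (n + 1)) (x : X) (k : Fin n) (c : ℕ+) : Prop :=
  k.castSucc < j ∧ ρ.upd k = some (x, c) ∧
    ∀ l, k < l → l.castSucc < j → ∀ c', ρ.upd l ≠ some (x, c')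

theorem LastUpdate.unique {ρ : TimedRun A n} {j : Fin (n + 1)} {x : X} {k k' : Fin n} {c c' : ℕ+}
    (h : ρ.LastUpdate j x k c) (h' : ρ.LastUpdate j x k' c') : k = k' ∧ c = c' := by
  have hk : k = k' := by
    rcases lt_trichotomy k k' with hl | hl | hl
    · exact absurd h'.2.1 (h.2.2 _ hl h'.1 _)
    · exact hl
    · exact absurd h.2.1 (h'.2.2 _ hl h.1 _)
  subst hk
  have := h.2.1.symm.trans h'.2.1
  simp at this
  exact ⟨rfl, this⟩

theorem lastUpdate_succ_self {ρ : TimedRun A n} {k : Fin n} {x : X} {c : ℕ+}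
    (h : ρ.upd k = some (x, c)) : ρ.LastUpdate k.succ x k c :=
  ⟨Fin.castSucc_lt_succ, h, fun l h1 h2 => by
    simp only [Fin.lt_def, Fin.val_castSucc, Fin.val_succ] at h1 h2; omega⟩

theorem LastUpdate.succ {ρ : TimedRun A n} {k l : Fin n} {x : X} {c : ℕ+}
    (h : ∀ c', ρ.upd k ≠ some (x, c')) (hl : ρ.LastUpdate k.castSucc x l c) :
    ρ.LastUpdate k.succ x l c := by
  refine ⟨hl.1.trans Fin.castSucc_lt_succ, hl.2.1, fun j h1 h2 => ?_⟩
  by_cases hj : j = k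
  · subst hj; exact h
  · refine hl.2.2 j h1 ?_
    simp only [Fin.lt_def, Fin.val_castSucc, Fin.val_succ, Fin.ext_iff] at *
    omega

theorem mem_active_castSucc (ρ : TimedRun A n) {k : Fin n} {x : X}
    (hx : x ∈ A.active (ρ.pre k.succ).state) (h : ∀ c, ρ.upd k ≠ some (x, c)) :
    x ∈ A.active (ρ.pre k.castSucc).state := by
  have ht := ρ.trans_eq k
  rcases hu : ρ.upd k with _ | ⟨y, c⟩
  · rw [hu] at ht
    exact A.active_of_no_update _ _ _ ht hx
  · rw [hu] at ht
    refine (A.active_of_update _ _ _ _ _ ht).2 ⟨hx, ?_⟩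
    rintro rfl
    exact h c hu

theorem mem_active_of_upd (ρ : TimedRun A n) {k : Fin n} {x : X} {c : ℕ+}
    (h : ρ.upd k = some (x, c)) : x ∈ A.active (ρ.pre k.succ).state := by
  have ht := ρ.trans_eq k
  rw [h] at ht
  exact (A.active_of_update _ _ _ _ _ ht).1

theorem discardsAt_iff (ρ : TimedRun A n) {k : Fin n} {x : X} :
    ρ.DiscardsAt k x ↔ x ∈ A.active (ρ.pre k.castSucc).state ∧ ρ.act k ≠ TAction.timeout x ∧
      (x ∉ A.active (ρ.pre k.succ).state ∨ ∃ c : ℕ+, ρ.upd k = some (x, c)) := by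
  rw [DiscardsAt, Discards, post_state]

theorem mem_active_of_timeout (ρ : TimedRun A n) {k : Fin n} {x : X}
    (h : ρ.act k = TAction.timeout x) : x ∈ A.active (ρ.pre k.castSucc).state := by
  have := (ρ.act_step k).2.1 x h
  rw [← post_state]
  exact ((ρ.post k.castSucc).dom x).1 (by simp [this])

/-- Only an update activates a timer, so going back from `j` must meet one. A step that leaves `x`
active without updating it neither discards `x` nor is its timeout, because a timeout restarts or
stops its timer. -/
theorem exists_lastUpdate (ρ : TimedRun A n) {j : Fin (n + 1)} {x : X}
    (hx : x ∈ A.active (ρ.pre j).state) :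
    ∃ k c, ρ.LastUpdate j x k c ∧
      ∀ l, k < l → l.castSucc < j → ρ.act l ≠ TAction.timeout x ∧ ¬ ρ.DiscardsAt l x := by
  induction j using Fin.induction with
  | zero => rw [ρ.pre_zero] at hx; simp [initConfig, A.active_init] at hx
  | succ k ih =>
    by_cases h : ∃ c, ρ.upd k = some (x, c)
    · obtain ⟨c, hc⟩ := h
      refine ⟨k, c, lastUpdate_succ_self hc, fun l h1 h2 => ?_⟩
      simp only [Fin.lt_def, Fin.val_castSucc, Fin.val_succ] at h1 h2
      omega
    · have h' : ∀ c, ρ.upd k ≠ some (x, c) := fun c hc => h ⟨c, hc⟩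
      obtain ⟨l, c, hl, hl'⟩ := ih (ρ.mem_active_castSucc hx h')
      refine ⟨l, c, hl.succ h', fun i h1 h2 => ?_⟩
      by_cases hi : i = k
      · subst hi
        constructor
        · intro ha
          have ht := ρ.trans_eq i
          rcases hu : ρ.upd i with _ | ⟨y, c⟩
          · rw [hu, ha] at ht
            exact A.timeout_no_update _ _ _ ht hx
          · rw [hu, ha] at ht
            obtain rfl := A.timeout_update _ _ _ _ _ ht
            exact h' _ hu
        · rw [discardsAt_iff]
          rintro ⟨-, -, h3 | h3⟩
          · exact h3 hx
          · exact h h3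
      · refine hl' i h1 ?_
        simp only [Fin.lt_def, Fin.val_castSucc, Fin.val_succ, Fin.ext_iff] at *
        omega

theorem LastUpdate.not_between {ρ : TimedRun A n} {j : Fin (n + 1)} {x : X} {k l : Fin n} {c : ℕ+}
    (h : ρ.LastUpdate j x k c) (hx : x ∈ A.active (ρ.pre j).state) (h1 : k < l)
    (h2 : l.castSucc < j) : ρ.act l ≠ TAction.timeout x ∧ ¬ ρ.DiscardsAt l x := by
  obtain ⟨k', c', h', hb⟩ := ρ.exists_lastUpdate hx
  obtain ⟨rfl, -⟩ := h.unique h'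
  exact hb l h1 h2

theorem mem_active_forward (ρ : TimedRun A n) {j : Fin (n + 1)} {x : X} {k : Fin n} {c : ℕ+}
    (hk : ρ.upd k = some (x, c)) (hj : k.castSucc < j)
    (h : ∀ l, k < l → l.castSucc < j → ρ.act l ≠ TAction.timeout x ∧ ¬ ρ.DiscardsAt l x) :
    x ∈ A.active (ρ.pre j).state := by
  induction j using Fin.induction with
  | zero => simp at hj
  | succ l ih =>
    by_cases hl : l = k
    · subst hl; exact ρ.mem_active_of_upd hk
    · have hkl : k < l := by
        simp only [Fin.lt_def, Fin.val_castSucc, Fin.val_succ, Fin.ext_iff] at *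
        omega
      have h1 := ih (Fin.castSucc_lt_castSucc_iff.2 hkl)
        fun i h1 h2 => h i h1 (h2.trans Fin.castSucc_lt_succ)
      obtain ⟨h2, h3⟩ := h l hkl Fin.castSucc_lt_succ
      by_contra hc
      exact h3 (ρ.discardsAt_iff.2 ⟨h1, h2, Or.inl hc⟩)

/-- A timer that is neither timed out nor discarded stays active, so a further update of it would
count as a discard. -/
theorem lastUpdate_of_not_between (ρ : TimedRun A n) {j : Fin (n + 1)} {x : X} {k : Fin n} {c : ℕ+}
    (hk : ρ.upd k = some (x, c)) (hj : k.castSucc < j)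
    (h : ∀ l, k < l → l.castSucc < j → ρ.act l ≠ TAction.timeout x ∧ ¬ ρ.DiscardsAt l x) :
    ρ.LastUpdate j x k c := by
  refine ⟨hj, hk, fun l h1 h2 c' hc => ?_⟩
  have hx := ρ.mem_active_forward (j := l.castSucc) hk (Fin.castSucc_lt_castSucc_iff.2 h1)
    fun i h3 h4 => h i h3 (h4.trans h2)
  exact (h l h1 h2).2 (ρ.discardsAt_iff.2 ⟨hx, (h l h1 h2).1, Or.inr ⟨c', hc⟩⟩)

/-- This formula turns every condition on timer values into a linear one on the times of actions,
which is what makes retiming tractable. -/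
theorem LastUpdate.val {ρ : TimedRun A n} {j : Fin (n + 1)} {x : X} {k : Fin n} {c : ℕ+}
    (h : ρ.LastUpdate j x k c) (hx : x ∈ A.active (ρ.pre j).state) :
    (ρ.post j).val x = some ((c : ℕ) + ρ.time k.castSucc - ρ.time j) := by
  induction j using Fin.induction generalizing k c with
  | zero => exact absurd h.1 (by simp)
  | succ l ih =>
    obtain ⟨hs1, hs2⟩ := (ρ.act_step l).2.2 x hx
    rw [(ρ.delay_step _).2.2.2]
    by_cases hu : ∃ c, ρ.upd l = some (x, c)
    · obtain ⟨c', hc⟩ := hu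
      obtain ⟨rfl, rfl⟩ := (lastUpdate_succ_self hc).unique h
      rw [hs1 _ hc, time_succ]
      simp
      ring
    · have h' : ∀ c, ρ.upd l ≠ some (x, c) := fun c hc => hu ⟨c, hc⟩
      have hx' := ρ.mem_active_castSucc hx h'
      obtain ⟨k', c', hk', -⟩ := ρ.exists_lastUpdate hx'
      obtain ⟨rfl, rfl⟩ := (hk'.succ h').unique h
      rw [hs2 h', ih hk' hx', time_succ]
      simp
      ring

/-- A timer is active at its timeout, so "no timeout or discard in between" reduces to "no update in
between", a condition on updates alone. -/
theorem triggers_iff (ρ : TimedRun A n) {k k' : Fin n} :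
    ρ.Triggers k k' ↔ ∃ x c, ρ.LastUpdate k'.castSucc x k c ∧ ρ.act k' = TAction.timeout x := by
  constructor
  · rintro ⟨hlt, x, ⟨c, hc⟩, ha, hb⟩
    exact ⟨x, c, ρ.lastUpdate_of_not_between hc (Fin.castSucc_lt_castSucc_iff.2 hlt)
      fun l h1 h2 => hb l h1 (Fin.castSucc_lt_castSucc_iff.1 h2), ha⟩
  · rintro ⟨x, c, h, ha⟩
    exact ⟨Fin.castSucc_lt_castSucc_iff.1 h.1, x, ⟨c, h.2.1⟩, ha, fun l h1 h2 =>
      h.not_between (ρ.mem_active_of_timeout ha) h1 (Fin.castSucc_lt_castSucc_iff.2 h2)⟩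

/-- A timeout names its timer, whose last update is unique. Together with `Triggers.right_unique`
this makes triggering a partial injection, so blocks are its maximal chains. -/
theorem Triggers.left_unique {ρ : TimedRun A n} {k k' l : Fin n} (h : ρ.Triggers k l)
    (h' : ρ.Triggers k' l) : k = k' := by
  obtain ⟨x, c, h1, h2⟩ := ρ.triggers_iff.1 h
  obtain ⟨x', c', h1', h2'⟩ := ρ.triggers_iff.1 h'
  obtain rfl : x = x' := by simpa using h2.symm.trans h2'
  exact (h1.unique h1').1

theorem Triggers.right_unique {ρ : TimedRun A n} {k l l' : Fin n} (h : ρ.Triggers k l)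
    (h' : ρ.Triggers k l') : l = l' := by
  obtain ⟨hlt, x, ⟨c, hc⟩, ha, hb⟩ := h
  obtain ⟨hlt', x', ⟨c', hc'⟩, ha', hb'⟩ := h'
  obtain rfl : x = x' := by
    have := hc.symm.trans hc'
    simp at this
    exact this.1
  rcases lt_trichotomy l l' with hl | hl | hl
  · exact absurd ha (hb' l hlt hl).1
  · exact hl
  · exact absurd ha' (hb l' hlt' hl).1

/-- The timer runs down from a positive value to zero, which takes time. -/
theorem Triggers.time_lt {ρ : TimedRun A n} {k l : Fin n} (h : ρ.Triggers k l) :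
    ρ.time k.castSucc < ρ.time l.castSucc := by
  obtain ⟨x, c, h1, h2⟩ := ρ.triggers_iff.1 h
  have hv := h1.val (ρ.mem_active_of_timeout h2)
  rw [(ρ.act_step l).2.1 x h2, Option.some_inj] at hv
  have : (0 : ℝ) < (c : ℕ) := by exact_mod_cast c.pos
  linarith

theorem exists_triggers (ρ : TimedRun A n) {k : Fin n} {x : X} (h : ρ.act k = TAction.timeout x) :
    ∃ k', ρ.Triggers k' k := by
  obtain ⟨k', c, h', -⟩ := ρ.exists_lastUpdate (ρ.mem_active_of_timeout h)
  exact ⟨k', ρ.triggers_iff.2 ⟨x, c, h', h⟩⟩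

end TimedRun

end TimerAutomaton

/-! ### Blocks as classes of actions -/

namespace TimerAutomaton

variable {X I Q : Type*} {A : TimerAutomaton X I Q}

namespace TimedRun

variable {n : ℕ}

open Relation

/-- Two actions are in the same block: one of them leads to the other by triggering. -/
def SameBlock (ρ : TimedRun A n) (k k' : Fin n) : Prop :=
  ReflTransGen ρ.Triggers k k' ∨ ReflTransGen ρ.Triggers k' k

theorem SameBlock.symm {ρ : TimedRun A n} {k k' : Fin n} (h : ρ.SameBlock k k') :
    ρ.SameBlock k' k := Or.symm h

theorem SameBlock.refl (ρ : TimedRun A n) (k : Fin n) : ρ.SameBlock k k := Or.inl .refl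

theorem lt_of_transGen_triggers {ρ : TimedRun A n} {k k' : Fin n}
    (h : TransGen ρ.Triggers k k') : k < k' := by
  induction h with
  | single h => exact h.1
  | tail _ h ih => exact ih.trans h.1

theorem time_lt_of_transGen_triggers {ρ : TimedRun A n} {k k' : Fin n}
    (h : TransGen ρ.Triggers k k') : ρ.time k.castSucc < ρ.time k'.castSucc := by
  induction h with
  | single h => exact h.time_lt
  | tail _ h ih => exact ih.trans h.time_lt

theorem IsTriggerSeq.pairwise {ρ : TimedRun A n} {L : List (Fin n)} (h : ρ.IsTriggerSeq L) :
    L.Pairwise (TransGen ρ.Triggers) :=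
  List.isChain_iff_pairwise.1 (h.2.imp fun _ _ => TransGen.single)

theorem IsTriggerSeq.pairwise_lt {ρ : TimedRun A n} {L : List (Fin n)} (h : ρ.IsTriggerSeq L) :
    L.Pairwise (· < ·) := h.pairwise.imp lt_of_transGen_triggers

theorem IsTriggerSeq.length_le {ρ : TimedRun A n} {L : List (Fin n)} (h : ρ.IsTriggerSeq L) :
    L.length ≤ n := by
  have : L.Nodup := h.pairwise_lt.imp fun h => h.ne
  simpa using this.length_le_card

theorem IsTriggerSeq.concat {ρ : TimedRun A n} {L : List (Fin n)} {k k' : Fin n}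
    (h : ρ.IsTriggerSeq L) (hk : L.getLast? = some k) (hkk : ρ.Triggers k k') :
    ρ.IsTriggerSeq (L ++ [k']) := by
  refine ⟨?_, ?_⟩
  · obtain ⟨a, i, h1, h2⟩ := h.1
    exact ⟨a, i, by simp [List.head?_append, h1], h2⟩
  · refine List.isChain_append.2 ⟨h.2, by simp, ?_⟩
    intro x hx y hy
    rw [hk] at hx
    simp at hx hy
    subst hx hy
    exact hkk

theorem exists_isTriggerSeq_getLast (ρ : TimedRun A n) (k : Fin n) :
    ∃ L, ρ.IsTriggerSeq L ∧ L.getLast? = some k := by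
  induction k using WellFoundedLT.induction with
  | ind k ih =>
    rcases hk : ρ.act k with i | x
    · exact ⟨[k], ⟨⟨k, i, rfl, hk⟩, by simp⟩, rfl⟩
    · obtain ⟨k', h'⟩ := ρ.exists_triggers hk
      obtain ⟨L, hL, hl⟩ := ih k' h'.1
      exact ⟨L ++ [k], hL.concat hl h', by simp⟩

theorem exists_block (ρ : TimedRun A n) (k : Fin n) : ∃ B : Block ρ, k ∈ B.seq := by
  -- Trigger sequences are strictly increasing, hence of length at most `n`. One of greatest length
  -- through `k` is maximal.
  let P : ℕ → Prop := fun m => ∃ L, ρ.IsTriggerSeq L ∧ k ∈ L ∧ L.length = m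
  obtain ⟨L₀, hL₀, hl₀⟩ := ρ.exists_isTriggerSeq_getLast k
  classical
  have hP : P L₀.length := ⟨L₀, hL₀, List.mem_of_getLast? hl₀, rfl⟩
  obtain ⟨L, hL, hkL, hlen⟩ : P (Nat.findGreatest P n) :=
    Nat.findGreatest_spec hL₀.length_le hP
  obtain ⟨z, hz⟩ : ∃ z, L.getLast? = some z := by
    cases L with
    | nil => simp at hkL
    | cons a t => exact ⟨_, List.getLast?_eq_getLast_of_ne_nil (by simp)⟩
  refine ⟨⟨L, ρ.timerFate z, hL, fun L' hL' hs => ?_, z, hz, rfl⟩, hkL⟩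
  refine (hs.eq_of_length_le ?_).symm
  rw [hlen]
  exact Nat.le_findGreatest hL'.length_le ⟨L', hL', hs.subset hkL, rfl⟩

/-- If `k` is last, the sequence can be prolonged, against maximality; otherwise the next entry is
triggered by `k` and is `k'` by uniqueness. -/
theorem Block.mem_of_triggers {ρ : TimedRun A n} (B : Block ρ) {k k' : Fin n} (hk : k ∈ B.seq)
    (h : ρ.Triggers k k') : k' ∈ B.seq := by
  obtain ⟨P, S, hPS⟩ := List.append_of_mem hk
  cases S with
  | nil =>
    have h1 := B.isTriggerSeq.concat (k := k) (by simp [hPS]) h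
    have h2 := B.maximal _ h1 (List.sublist_append_left _ _)
    rw [← h2]
    simp
  | cons a S =>
    have h1 := B.isTriggerSeq.2
    rw [hPS, List.isChain_append] at h1
    have h2 := h1.2.1
    rw [List.isChain_cons_cons] at h2
    rw [hPS, h.right_unique h2.1]
    simp

/-- The head of a block is an input, so a triggered action has a predecessor in the block, and this
is its only trigger. -/
theorem Block.mem_of_triggered {ρ : TimedRun A n} (B : Block ρ) {k k' : Fin n} (hk : k' ∈ B.seq)
    (h : ρ.Triggers k k') : k ∈ B.seq := by
  obtain ⟨P, S, hPS⟩ := List.append_of_mem hk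
  rcases List.eq_nil_or_concat P with rfl | ⟨P, a, rfl⟩
  · obtain ⟨a, i, h1, h2⟩ := B.isTriggerSeq.1
    rw [hPS] at h1
    simp at h1
    subst h1
    obtain ⟨-, x, -, h3, -⟩ := h
    rw [h2] at h3
    simp at h3
  · have h1 := B.isTriggerSeq.2
    rw [hPS, List.isChain_append] at h1
    have h2 := h1.2.2 a (by simp) k' (by simp)
    rw [hPS, h.left_unique h2]
    simp

theorem Block.mem_of_sameBlock {ρ : TimedRun A n} (B : Block ρ) {k k' : Fin n} (hk : k ∈ B.seq)
    (h : ρ.SameBlock k k') : k' ∈ B.seq := by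
  rcases h with h | h
  · induction h with
    | refl => exact hk
    | tail _ h ih => exact B.mem_of_triggers ih h
  · induction h using ReflTransGen.head_induction_on with
    | refl => exact hk
    | head h _ ih => exact B.mem_of_triggered ih h

theorem Block.sameBlock {ρ : TimedRun A n} (B : Block ρ) {k k' : Fin n} (hk : k ∈ B.seq)
    (hk' : k' ∈ B.seq) : ρ.SameBlock k k' := by
  have h := (B.isTriggerSeq.pairwise.imp (S := ρ.SameBlock)
    fun h => Or.inl h.to_reflTransGen)
  by_cases hkk : k = k'
  · subst hkk; exact SameBlock.refl ρ k
  · have : Std.Symm ρ.SameBlock := ⟨fun _ _ => SameBlock.symm⟩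
    exact h.forall hk hk' hkk

theorem Block.time_lt {ρ : TimedRun A n} (B : Block ρ) {k k' : Fin n} (hk : k ∈ B.seq)
    (hk' : k' ∈ B.seq) (hlt : k < k') : ρ.time k.castSucc < ρ.time k'.castSucc := by
  rcases B.sameBlock hk hk' with h | h <;> rcases reflTransGen_iff_eq_or_transGen.1 h with h | h
  · exact absurd h hlt.ne'
  · exact time_lt_of_transGen_triggers h
  · exact absurd h hlt.ne
  · exact absurd (lt_of_transGen_triggers h) hlt.asymm

theorem Block.ext_seq {ρ : TimedRun A n} {B B' : Block ρ} (h : B.seq = B'.seq) : B = B' := by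
  obtain ⟨s, f, h1, h2, k, h3, h4⟩ := B
  obtain ⟨s', f', h1', h2', k', h3', h4'⟩ := B'
  obtain rfl : s = s' := h
  obtain rfl : k = k' := Option.some.inj (h3.symm.trans h3')
  obtain rfl : f = f' := h4.trans h4'.symm
  rfl

/-- As a set, a block is the `SameBlock` class of any of its actions; as a list it is sorted; its
fate is determined by its last action. So blocks partition the actions, and races can be studied on
actions. -/
theorem Block.eq_of_mem {ρ : TimedRun A n} {B B' : Block ρ} {k : Fin n} (hk : k ∈ B.seq)
    (hk' : k ∈ B'.seq) : B = B' := by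
  refine Block.ext_seq (List.Perm.eq_of_pairwise (le := (· < ·))
    (fun a b _ _ h1 h2 => absurd h1 h2.asymm)
    B.isTriggerSeq.pairwise_lt B'.isTriggerSeq.pairwise_lt ?_)
  refine (List.perm_ext_iff_of_nodup (B.isTriggerSeq.pairwise_lt.imp fun h => h.ne)
    (B'.isTriggerSeq.pairwise_lt.imp fun h => h.ne)).2 fun a => ?_
  exact ⟨fun h => B'.mem_of_sameBlock hk' (B.sameBlock hk h),
    fun h => B.mem_of_sameBlock hk (B'.sameBlock hk' h)⟩

theorem Block.getLast_iff {ρ : TimedRun A n} (B : Block ρ) {k : Fin n} (hk : k ∈ B.seq) :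
    B.seq.getLast? = some k ↔ ∀ k', ¬ ρ.Triggers k k' := by
  constructor
  · intro h k' hkk
    have h2 := B.maximal _ (B.isTriggerSeq.concat h hkk) (List.sublist_append_left _ _)
    simp at h2
  · intro h
    obtain ⟨P, S, hPS⟩ := List.append_of_mem hk
    cases S with
    | nil => simp [hPS]
    | cons a S =>
      have h1 := B.isTriggerSeq.2
      rw [hPS, List.isChain_append] at h1
      have h2 := h1.2.1
      rw [List.isChain_cons_cons] at h2
      exact absurd h2.1 (h a)

end TimedRun

end TimerAutomaton

/-! ### Races as edges between actions -/

namespace TimerAutomaton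

variable {X I Q : Type*} {A : TimerAutomaton X I Q}

namespace TimedRun

variable {n : ℕ}

open Relation

/-- The order of the two actions `p` and `q` is forced: `q` happens after `p` without delay, or
`p` discards the timer started by `q` when its value is zero, so that `q` must not be moved to the
left of `p`. -/
def Edge (ρ : TimedRun A n) (p q : Fin n) : Prop :=
  (p < q ∧ ρ.time p.castSucc = ρ.time q.castSucc) ∨
  ∃ x c, ρ.LastUpdate p.castSucc x q c ∧ ρ.DiscardsAt p x ∧ (ρ.post p.castSucc).val x = some 0

/-- A triggered action before `p` would be a forbidden timeout in between, `p` itself is a discard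
and not the timeout, and after `p` the timer started by `q` has been discarded. -/
theorem LastUpdate.not_triggers {ρ : TimedRun A n} {p q : Fin n} {x : X} {c : ℕ+}
    (h : ρ.LastUpdate p.castSucc x q c) (hd : ρ.DiscardsAt p x) (l : Fin n) :
    ¬ ρ.Triggers q l := by
  rintro ⟨hlt, y, ⟨c', hc⟩, ha, hb⟩
  have hx : x = y := by
    have := h.2.1.symm.trans hc
    simp at this
    exact this.1
  subst hx
  rw [discardsAt_iff] at hd
  rcases lt_trichotomy l p with hl | hl | hl
  · exact (h.not_between hd.1 hlt (Fin.castSucc_lt_castSucc_iff.2 hl)).1 ha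
  · subst hl; exact hd.2.1 ha
  · exact (hb p (Fin.castSucc_lt_castSucc_iff.1 h.1) hl).2 (ρ.discardsAt_iff.2 hd)

/-- Time increases strictly along a block, which excludes simultaneity. In the discard case `q`
triggers nothing although it precedes `p`. -/
theorem Edge.not_mem {ρ : TimedRun A n} {p q : Fin n} (h : ρ.Edge p q) (B : Block ρ)
    (hp : p ∈ B.seq) : q ∉ B.seq := by
  intro hq
  rcases h with ⟨h1, h2⟩ | ⟨x, c, h1, h2, -⟩
  · exact (B.time_lt hp hq h1).ne h2
  · have hqp : q < p := Fin.castSucc_lt_castSucc_iff.1 h1.1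
    rcases B.sameBlock hq hp with h | h
    · rcases h.cases_head with h | ⟨l, h, -⟩
      · exact hqp.ne h
      · exact h1.not_triggers h2 l h
    · rcases reflTransGen_iff_eq_or_transGen.1 h with h | h
      · exact hqp.ne h
      · exact (lt_of_transGen_triggers h).asymm hqp

/-- In the discard case the source of the timer triggers nothing, so it ends its block, and the
discard at zero gives that block the fate `newMoon`. -/
theorem raceCase_of_edge {ρ : TimedRun A n} {B B' : Block ρ} {p q : Fin n} (hp : p ∈ B.seq)
    (hq : q ∈ B'.seq) (h : ρ.Edge p q) : RaceCase B B' := by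
  rcases h with ⟨h1, h2⟩ | ⟨x, c, h1, h2, h3⟩
  · exact Or.inl ⟨p, hp, q, hq, ρ.elapsed_eq_zero.2 h2⟩
  · have hl : B'.seq.getLast? = some q := (B'.getLast_iff hq).2 (h1.not_triggers h2)
    have hf : ρ.FirstDiscard q p x := ⟨⟨c, h1.2.1⟩, Fin.castSucc_lt_castSucc_iff.1 h1.1, h2,
      fun j h3 h4 => (h1.not_between (ρ.discardsAt_iff.1 h2).1 h3
        (Fin.castSucc_lt_castSucc_iff.2 h4)).2⟩
    refine Or.inr ⟨?_, p, hp, q, x, hl, hf⟩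
    obtain ⟨q', h4, h5⟩ := B'.fate_eq
    obtain rfl : q = q' := Option.some.inj (hl.symm.trans h4)
    rw [h5, timerFate, if_neg (by simp [h1.2.1]), if_pos ⟨p, x, hf, h3⟩]

theorem edge_of_raceCase {ρ : TimedRun A n} {B B' : Block ρ} (hB : B ≠ B') (h : RaceCase B B') :
    ∃ p ∈ B.seq, ∃ q ∈ B'.seq, ρ.Edge p q ∨ ρ.Edge q p := by
  rcases h with ⟨p, hp, q, hq, h⟩ | ⟨hf, p, hp, q, x, hl, hd⟩
  · refine ⟨p, hp, q, hq, ?_⟩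
    rw [elapsed_eq_zero] at h
    rcases lt_trichotomy p q with hpq | hpq | hpq
    · exact Or.inl (Or.inl ⟨hpq, h⟩)
    · subst hpq; exact absurd (Block.eq_of_mem hp hq) hB
    · exact Or.inr (Or.inl ⟨hpq, h.symm⟩)
  · have hq : q ∈ B'.seq := List.mem_of_getLast? hl
    refine ⟨p, hp, q, hq, Or.inl (Or.inr ?_)⟩
    obtain ⟨q', h4, h5⟩ := B'.fate_eq
    obtain rfl : q = q' := Option.some.inj (hl.symm.trans h4)
    obtain ⟨⟨c, hc⟩, hqp, hdp, hb⟩ := hd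
    have hfate : ∃ l x, ρ.FirstDiscard q l x ∧ (ρ.post l.castSucc).val x = some 0 := by
      by_contra hcon
      rw [h5, timerFate, if_neg (by simp [hc]), if_neg hcon] at hf
      cases hf
    -- The fate provides a first discard at value zero; the first discard of this timer being
    -- unique, it is the action `p` of `B`.
    obtain ⟨l, y, ⟨⟨c', hc'⟩, hql, hdl, hb'⟩, hv⟩ := hfate
    obtain rfl : x = y := by
      have := hc.symm.trans hc'
      simp at this
      exact this.1
    obtain rfl : l = p := by
      rcases lt_trichotomy l p with hlp | hlp | hlp
      · exact absurd hdl (hb l hql hlp)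
      · exact hlp
      · exact absurd hdp (hb' p hqp hlp)
    -- The earliest timeout of `x` before the discard would be triggered by `q`, but `q` is the last
    -- action of its block.
    have hnt : ∀ j, q < j → j < l → ρ.act j ≠ TAction.timeout x := by
      intro j
      induction j using WellFoundedLT.induction with
      | ind j ih =>
        intro h1 h2 h3
        exact (B'.getLast_iff hq).1 hl j ⟨h1, x, ⟨c, hc⟩, h3, fun i h4 h5 =>
          ⟨ih i h5 h4 (h5.trans h2), hb i h4 (h5.trans h2)⟩⟩
    refine ⟨x, c, ρ.lastUpdate_of_not_between hc (Fin.castSucc_lt_castSucc_iff.2 hqp)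
      fun j h1 h2 => ?_, hdp, hv⟩
    have h2' := Fin.castSucc_lt_castSucc_iff.1 h2
    exact ⟨hnt j h1 h2', hb j h1 h2'⟩

/-- This removes blocks and fates from the definition of a race: only the relation `Edge` on actions
has to be followed under retiming and in the word. -/
theorem race_iff {ρ : TimedRun A n} {B B' : Block ρ} :
    Race B B' ↔ ∃ p ∈ B.seq, ∃ q ∈ B'.seq, ρ.Edge p q ∨ ρ.Edge q p := by
  constructor
  · rintro ⟨hB, h | h⟩
    · exact edge_of_raceCase hB h
    · obtain ⟨p, hp, q, hq, h⟩ := edge_of_raceCase hB.symm h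
      exact ⟨q, hq, p, hp, h.symm⟩
  · rintro ⟨p, hp, q, hq, h | h⟩
    · refine ⟨?_, Or.inl (raceCase_of_edge hp hq h)⟩
      rintro rfl
      exact h.not_mem B hp hq
    · refine ⟨?_, Or.inr (raceCase_of_edge hq hp h)⟩
      rintro rfl
      exact h.not_mem B hq hp

theorem inRace_iff {ρ : TimedRun A n} {B : Block ρ} :
    InRace B ↔ ∃ p ∈ B.seq, ∃ q, ρ.Edge p q ∨ ρ.Edge q p := by
  constructor
  · rintro ⟨B', h⟩
    obtain ⟨p, hp, q, -, h⟩ := race_iff.1 h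
    exact ⟨p, hp, q, h⟩
  · rintro ⟨p, hp, q, h⟩
    obtain ⟨B', hB'⟩ := ρ.exists_block q
    exact ⟨B', race_iff.2 ⟨p, hp, q, hB', h⟩⟩

theorem raceFree_iff {ρ : TimedRun A n} : RaceFree ρ ↔ ∀ p q, ¬ ρ.Edge p q := by
  constructor
  · intro h p q he
    obtain ⟨B, hB⟩ := ρ.exists_block p
    obtain ⟨B', hB'⟩ := ρ.exists_block q
    exact h B B' (race_iff.2 ⟨p, hB, q, hB', Or.inl he⟩)
  · intro h B B' hr
    obtain ⟨p, -, q, -, he | he⟩ := race_iff.1 hr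
    exacts [h _ _ he, h _ _ he]

/-- The graph of the blocks has a cycle: there is a nonempty set of actions such that the block of
each of them has an edge to the set. -/
def Cyclic (ρ : TimedRun A n) : Prop :=
  ∃ S : Set (Fin n), S.Nonempty ∧
    ∀ p ∈ S, ∃ p' q, ρ.SameBlock p p' ∧ ρ.Edge p' q ∧ q ∈ S

theorem not_cyclic_of_raceFree {ρ : TimedRun A n} (h : RaceFree ρ) : ¬ ρ.Cyclic := by
  rintro ⟨S, ⟨p, hp⟩, hS⟩
  obtain ⟨p', q, -, he, -⟩ := hS p hp
  exact raceFree_iff.1 h _ _ he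

end TimedRun

end TimerAutomaton

/-! ### Wigglable means acyclic -/

namespace TimerAutomaton

variable {X I Q : Type*} {A : TimerAutomaton X I Q}

theorem Config.ext_val {c c' : Config A} (hs : c.state = c'.state) (hv : c.val = c'.val) :
    c = c' := by
  cases c; cases c'; cases hs; cases hv; rfl

namespace TimedRun

variable {n : ℕ}

open Relation

section SameUntimed

variable {ρ ρ' : TimedRun A n}

theorem SameUntimed.symm (h : SameUntimed ρ ρ') : SameUntimed ρ' ρ :=
  ⟨fun j => (h.1 j).symm, fun k => (h.2 k).symm⟩

/-- The transition function is deterministic, so the untimed trace fixes the updates, and with them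
discards, triggering and blocks. -/
theorem SameUntimed.upd_eq (h : SameUntimed ρ ρ') (k : Fin n) : ρ.upd k = ρ'.upd k := by
  have h1 := ρ.trans_eq k
  have h2 := ρ'.trans_eq k
  rw [← h.1, ← h.1, ← h.2, h1] at h2
  simpa using h2

theorem SameUntimed.lastUpdate (h : SameUntimed ρ ρ') {j : Fin (n + 1)} {x : X} {k : Fin n}
    {c : ℕ+} (hl : ρ.LastUpdate j x k c) : ρ'.LastUpdate j x k c := by
  simpa only [LastUpdate, h.upd_eq] using hl

theorem SameUntimed.discardsAt (h : SameUntimed ρ ρ') {k : Fin n} {x : X}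
    (hd : ρ.DiscardsAt k x) : ρ'.DiscardsAt k x := by
  rw [discardsAt_iff] at hd ⊢
  rwa [← h.1, ← h.1, ← h.2, ← h.upd_eq]

theorem SameUntimed.triggers (h : SameUntimed ρ ρ') {k k' : Fin n}
    (ht : ρ.Triggers k k') : ρ'.Triggers k k' := by
  rw [triggers_iff] at ht ⊢
  obtain ⟨x, c, h1, h2⟩ := ht
  exact ⟨x, c, h.lastUpdate h1, h.2 k' ▸ h2⟩

theorem SameUntimed.sameBlock (h : SameUntimed ρ ρ') {k k' : Fin n}
    (ht : ρ.SameBlock k k') : ρ'.SameBlock k k' :=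
  ht.imp (ReflTransGen.mono (fun _ _ => h.triggers) _ _)
    (ReflTransGen.mono (fun _ _ => h.triggers) _ _)

end SameUntimed

theorem val_eq_zero_iff {ρ : TimedRun A n} {p q : Fin n} {x : X} {c : ℕ+}
    (h : ρ.LastUpdate p.castSucc x q c) (hd : ρ.DiscardsAt p x) :
    (ρ.post p.castSucc).val x = some 0 ↔
      (c : ℕ) + ρ.time q.castSucc - ρ.time p.castSucc = 0 := by
  rw [h.val (ρ.discardsAt_iff.1 hd).1, Option.some_inj]

theorem LastUpdate.nonneg {ρ : TimedRun A n} {j : Fin (n + 1)} {x : X} {k : Fin n} {c : ℕ+}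
    (h : ρ.LastUpdate j x k c) (hx : x ∈ A.active (ρ.pre j).state) :
    (0 : ℝ) ≤ (c : ℕ) + ρ.time k.castSucc - ρ.time j :=
  (ρ.post j).nonneg x _ (h.val hx)

open Classical in
/-- The displacement of the action before position `j` when the actions in `L` are moved by `ε`. -/
noncomputable def moved (L : List (Fin n)) (ε : ℝ) (j : Fin (n + 1)) : ℝ :=
  if ∃ k ∈ L, k.castSucc = j then ε else 0

theorem moved_mem {L : List (Fin n)} {ε : ℝ} {k : Fin n} (h : k ∈ L) :
    moved L ε k.castSucc = ε := if_pos ⟨k, h, rfl⟩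

theorem moved_not_mem {L : List (Fin n)} {ε : ℝ} {k : Fin n} (h : k ∉ L) :
    moved L ε k.castSucc = 0 := if_neg (by simpa using h)

theorem moved_last {L : List (Fin n)} {ε : ℝ} : moved L ε (Fin.last n) = 0 :=
  if_neg (by rintro ⟨k, -, h⟩; exact (Fin.castSucc_lt_last k).ne h)

theorem delayShift_zero (L : List (Fin n)) (ε : ℝ) : delayShift L ε 0 = moved L ε 0 := by
  have : ¬ ∃ k ∈ L, k.succ = 0 := by rintro ⟨k, -, h⟩; exact Fin.succ_ne_zero k h
  rw [delayShift, if_neg this, sub_zero, moved]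

theorem delayShift_succ (L : List (Fin n)) (ε : ℝ) (j : Fin n) :
    delayShift L ε j.succ = moved L ε j.succ - moved L ε j.castSucc := by
  simp only [delayShift, moved, Fin.succ_inj, Fin.castSucc_inj]

/-- `delayShift` is the discrete derivative of `moved`, so the changes of delays telescope to the
displacement of a single action. -/
theorem sum_delayShift (f : Fin (n + 1) → ℝ) (L : List (Fin n)) (ε : ℝ) (j : Fin (n + 1)) :
    ∑ i ∈ Finset.Iic j, (f i + delayShift L ε i) = (∑ i ∈ Finset.Iic j, f i) + moved L ε j := by
  induction j using Fin.induction with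
  | zero => rw [sum_Iic_zero, sum_Iic_zero, delayShift_zero]
  | succ k ih => rw [sum_Iic_succ, sum_Iic_succ, delayShift_succ, ih]; ring

theorem time_of_delayShift {ρ ρ' : TimedRun A n} {L : List (Fin n)} {ε : ℝ}
    (h : ∀ j, ρ'.delay j = ρ.delay j + delayShift L ε j) (j : Fin (n + 1)) :
    ρ'.time j = ρ.time j + moved L ε j := by
  simp only [time, h, sum_delayShift]

/-- Edges depend only on the times of their actions. -/
theorem Edge.of_time_eq {ρ ρ' : TimedRun A n} (hu : SameUntimed ρ ρ') {p q : Fin n}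
    (hp : ρ'.time p.castSucc = ρ.time p.castSucc) (hq : ρ'.time q.castSucc = ρ.time q.castSucc)
    (h : ρ.Edge p q) : ρ'.Edge p q := by
  rcases h with ⟨h3, h4⟩ | ⟨x, c, h3, h4, h5⟩
  · exact Or.inl ⟨h3, by rw [hp, hq, h4]⟩
  · refine Or.inr ⟨x, c, hu.lastUpdate h3, hu.discardsAt h4, ?_⟩
    rw [val_eq_zero_iff h3 h4] at h5
    rw [val_eq_zero_iff (hu.lastUpdate h3) (hu.discardsAt h4), hp, hq, h5]

theorem time_of_not_mem {ρ ρ' : TimedRun A n} {L : List (Fin n)} {ε : ℝ}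
    (ht : ∀ j, ρ'.time j = ρ.time j + moved L ε j) {k : Fin n} (hk : k ∉ L) :
    ρ'.time k.castSucc = ρ.time k.castSucc := by rw [ht, moved_not_mem hk, add_zero]

/-- An edge prevents increasing the time of its source relative to the time of its target. -/
theorem Edge.moved_le {ρ ρ' : TimedRun A n} {L : List (Fin n)} {ε : ℝ} (hu : SameUntimed ρ ρ')
    (ht : ∀ j, ρ'.time j = ρ.time j + moved L ε j) {p q : Fin n}
    (h : ρ.Edge p q) : moved L ε p.castSucc ≤ moved L ε q.castSucc := by
  have h1 := ht p.castSucc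
  have h2 := ht q.castSucc
  rcases h with ⟨h3, h4⟩ | ⟨x, c, h3, h4, h5⟩
  · have := ρ'.time_mono (Fin.castSucc_le_castSucc_iff.2 h3.le)
    linarith
  · have h6 := (hu.lastUpdate h3).nonneg (ρ'.discardsAt_iff.1 (hu.discardsAt h4)).1
    rw [val_eq_zero_iff h3 h4] at h5
    linarith

/-- No edge enters a block that moves left and none leaves one that moves right, so a cycle never
needs the moved block. Edges between unmoved actions persist. -/
theorem WiggleBlock.cyclic {ρ ρ' : TimedRun A n} (h : WiggleBlock ρ ρ') (hc : ρ.Cyclic) :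
    ρ'.Cyclic := by
  obtain ⟨-, -, hu, B, -, ⟨ε, hε, hd⟩, -⟩ := h
  have ht := time_of_delayShift hd
  obtain ⟨S, ⟨p₀, hp₀⟩, hS⟩ := hc
  rcases lt_or_gt_of_ne hε with hε | hε
  · have hin : ∀ p q, ρ.Edge p q → q ∉ B.seq := by
      intro p q he hq
      have hp : p ∉ B.seq := fun hp => he.not_mem B hp hq
      have := he.moved_le hu ht
      rw [moved_mem hq, moved_not_mem hp] at this
      linarith
    -- No edge ends in `B`, so all targets of edges lie outside `B` and the set stays nonempty and
    -- closed after removing `B`.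
    refine ⟨{p ∈ S | p ∉ B.seq}, ?_, ?_⟩
    · obtain ⟨p', q, -, he, hq⟩ := hS p₀ hp₀
      exact ⟨q, hq, hin _ _ he⟩
    · rintro p ⟨hp, hpB⟩
      obtain ⟨p', q, hb, he, hq⟩ := hS p hp
      exact ⟨p', q, hu.sameBlock hb, he.of_time_eq hu
        (time_of_not_mem ht fun h => hpB (B.mem_of_sameBlock h hb.symm))
        (time_of_not_mem ht (hin _ _ he)), hq, hin _ _ he⟩
  · have hout : ∀ p q, ρ.Edge p q → p ∉ B.seq := by
      intro p q he hp
      have := he.moved_le hu ht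
      rw [moved_mem hp, moved_not_mem (he.not_mem B hp)] at this
      linarith
    -- The block of each element of `S` has an outgoing edge and `B` has none, so `S` already avoids
    -- `B`.
    have hSB : ∀ p ∈ S, p ∉ B.seq := by
      intro p hp hpB
      obtain ⟨p', q, hb, he, -⟩ := hS p hp
      exact hout _ _ he (B.mem_of_sameBlock hpB hb)
    refine ⟨S, ⟨p₀, hp₀⟩, fun p hp => ?_⟩
    obtain ⟨p', q, hb, he, hq⟩ := hS p hp
    exact ⟨p', q, hu.sameBlock hb, he.of_time_eq hu
      (time_of_not_mem ht (hout _ _ he)) (time_of_not_mem ht (hSB q hq)), hq⟩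

theorem Cyclic.not_wigglable {ρ : TimedRun A n} (hc : ρ.Cyclic) : ¬ ρ.Wigglable := by
  rintro ⟨-, ρ', hw, hf⟩
  refine not_cyclic_of_raceFree hf ?_
  clear hf
  induction hw with
  | refl => exact hc
  | tail _ h ih => exact h.cyclic ih

section Retime

open Classical in
/-- The time at which the timer `x` of the configuration `j` expires, if the actions take place at
the times `T`. -/
noncomputable def expiry (ρ : TimedRun A n) (T : Fin (n + 1) → ℝ) (j : Fin (n + 1)) (x : X) : ℝ :=
  if h : ∃ k, ∃ c : ℕ+, ρ.LastUpdate j x k c then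
    (h.choose_spec.choose : ℕ) + T h.choose.castSucc else 0

theorem LastUpdate.expiry_eq {ρ : TimedRun A n} {j : Fin (n + 1)} {x : X} {k : Fin n} {c : ℕ+}
    (h : ρ.LastUpdate j x k c) (T : Fin (n + 1) → ℝ) :
    ρ.expiry T j x = (c : ℕ) + T k.castSucc := by
  have h' : ∃ k, ∃ c : ℕ+, ρ.LastUpdate j x k c := ⟨k, c, h⟩
  rw [expiry, dif_pos h']
  obtain ⟨h1, h2⟩ := h.unique h'.choose_spec.choose_spec
  rw [← h2, ← h1]

/-- Times of actions can be prescribed freely, provided that no active timer becomes negative and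
timeouts stay at value zero. Only differences of the times `T` matter, hence no condition on `T 0`.
The value of a timer is its expiry time minus the current time. -/
theorem exists_retime (ρ : TimedRun A n) (d T : Fin (n + 1) → ℝ) (hd : ∀ j, 0 ≤ d j)
    (hT : ∀ k : Fin n, T k.succ = T k.castSucc + d k.succ)
    (h1 : ∀ j x k c, ρ.LastUpdate j x k c → x ∈ A.active (ρ.pre j).state →
      (0 : ℝ) ≤ (c : ℕ) + T k.castSucc - T j)
    (h2 : ∀ k x l c, ρ.act k = TAction.timeout x → ρ.LastUpdate k.castSucc x l c →
      (c : ℕ) + T l.castSucc - T k.castSucc = 0) :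
    ∃ ρ' : TimedRun A n, SameUntimed ρ ρ' ∧ ρ'.delay = d := by
  classical
  have hpos : ∀ j x, x ∈ A.active (ρ.pre j).state → 0 ≤ ρ.expiry T j x - T j := by
    intro j x hx
    obtain ⟨k, c, hk, -⟩ := ρ.exists_lastUpdate hx
    rw [hk.expiry_eq]
    exact h1 j x k c hk hx
  let pre' : Fin (n + 1) → Config A := fun j =>
    { state := (ρ.pre j).state
      val := fun x => if x ∈ A.active (ρ.pre j).state then some (ρ.expiry T j x - T j + d j)
        else none
      dom := fun x => by split_ifs with h <;> simp [h]
      nonneg := fun x v hv => by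
        split_ifs at hv with h
        · simp at hv
          linarith [hpos j x h, hd j]
        }
  let post' : Fin (n + 1) → Config A := fun j =>
    { state := (ρ.pre j).state
      val := fun x => if x ∈ A.active (ρ.pre j).state then some (ρ.expiry T j x - T j)
        else none
      dom := fun x => by split_ifs with h <;> simp [h]
      nonneg := fun x v hv => by
        split_ifs at hv with h
        · simp at hv
          linarith [hpos j x h] }
  refine ⟨⟨pre', d, post', ρ.act, ρ.upd, ?_, ?_, ?_⟩, ⟨fun _ => rfl, fun _ => rfl⟩, rfl⟩
  · have hs : (ρ.pre 0).state = A.init := by rw [ρ.pre_zero]; rfl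
    refine Config.ext_val hs ?_
    funext x
    have : x ∉ A.active (ρ.pre 0).state := by rw [hs, A.active_init]; simp
    simp [pre', this, initConfig]
  · intro j
    refine ⟨hd j, rfl, fun x v hv => ?_, fun x => ?_⟩
    · simp only [pre'] at hv
      split_ifs at hv with h
      · simp at hv
        linarith [hpos j x h]
    · simp only [pre', post']
      split_ifs with h <;> simp
  · intro k
    refine ⟨ρ.trans_eq k, fun x hx => ?_, fun y hy => ⟨fun c hc => ?_, fun hc => ?_⟩⟩
    · have hact := ρ.mem_active_of_timeout hx
      obtain ⟨l, c, hl, -⟩ := ρ.exists_lastUpdate hact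
      simp only [post', if_pos hact, hl.expiry_eq, Option.some_inj]
      exact h2 k x l c hx hl
    · have hy' : y ∈ A.active (ρ.pre k.succ).state := hy
      simp only [pre', if_pos hy', (lastUpdate_succ_self hc).expiry_eq, Option.some_inj, hT]
      ring
    · have hy' : y ∈ A.active (ρ.pre k.succ).state := hy
      have hy'' := ρ.mem_active_castSucc hy' hc
      obtain ⟨l, c, hl, -⟩ := ρ.exists_lastUpdate hy''
      simp only [pre', post', if_pos hy', if_pos hy'', hl.expiry_eq, (hl.succ hc).expiry_eq,
        Option.some_inj, hT]
      ring

end Retime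

theorem exists_pos_lt {ι : Type*} [Finite ι] (f : ι → ℝ) :
    ∃ ε > 0, ∀ i, 0 < f i → ε < f i := by
  classical
  have := Fintype.ofFinite ι
  obtain ⟨ε, h1, h2⟩ := Order.exists_between_finsets (lo := ({0} : Finset ℝ))
    (hi := (Finset.univ.image f).filter (0 < ·)) (by simp)
  exact ⟨ε, h1 0 (by simp), fun i hi => h2 _ (by simp [hi])⟩

/-- A block that participates in a race but has no outgoing edges can be moved to the right. -/
theorem exists_wiggleBlock {ρ : TimedRun A n} (hρ : ρ.Padded) (B : Block ρ) (hB : InRace B)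
    (hout : ∀ p ∈ B.seq, ∀ q, ¬ ρ.Edge p q) :
    ∃ ρ', WiggleBlock ρ ρ' ∧ (∀ p q, ρ'.Edge p q → ρ.Edge p q) ∧
      ∀ p ∈ B.seq, ∀ q, ¬ ρ'.Edge p q ∧ ¬ ρ'.Edge q p := by
  obtain ⟨hρ0, hρ1, hρ2⟩ := hρ
  -- `ε` is below every positive gap between times and every positive remaining value of a started
  -- timer. Actions without update contribute at index `j` the number 0 minus a gap of times plus
  -- their own time; bounding these extra numbers is harmless.
  obtain ⟨ε, hε, hlt⟩ := exists_pos_lt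
    (fun i : (Fin (n + 1) × Fin (n + 1)) ⊕ (Fin n × Fin (n + 1)) =>
      i.elim (fun i => ρ.time i.2 - ρ.time i.1)
        (fun i => (((ρ.upd i.1).elim 0 fun u => (u.2 : ℕ)) : ℕ) +
          ρ.time i.1.castSucc - ρ.time i.2))
  have hε1 : ∀ i j, ρ.time i < ρ.time j → ε < ρ.time j - ρ.time i := fun i j h =>
    hlt (Sum.inl (i, j)) (sub_pos.2 h)
  have hε2 : ∀ k j x c, ρ.upd k = some (x, c) →
      (0 : ℝ) < (c : ℕ) + ρ.time k.castSucc - ρ.time j →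
      ε < (c : ℕ) + ρ.time k.castSucc - ρ.time j := by
    intro k j x c h h'
    have := hlt (Sum.inr (k, j))
    simp only [Sum.elim_inr, h, Option.elim_some] at this
    exact this h'
  clear hlt
  have hmv : ∀ j, moved B.seq ε j = 0 ∨ moved B.seq ε j = ε := by
    intro j
    rw [moved]
    split_ifs <;> simp
  have hmv0 : ∀ j, 0 ≤ moved B.seq ε j := fun j => by
    rcases hmv j with h | h <;> rw [h]
    exact hε.le
  -- delays after the actions of the block are positive
  have hafter : ∀ p ∈ B.seq, ρ.time p.castSucc < ρ.time p.succ := by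
    intro p hp
    have hdel := ρ.time_succ p
    have hnn := ρ.delay_nonneg p.succ
    rcases eq_or_ne p.succ (Fin.last n) with hl | hl
    · rw [hl] at hdel ⊢
      linarith
    · obtain ⟨q, hq⟩ := Fin.exists_castSucc_eq.2 hl
      have hpq : p < q := by
        rw [← Fin.castSucc_lt_castSucc_iff, hq]
        exact Fin.castSucc_lt_succ
      -- A zero delay after `p` would make the next action simultaneous, which is an edge leaving
      -- the block; the last delay is positive by padding.
      refine lt_of_le_of_ne (by linarith) fun he => hout p hp q (Or.inl ⟨hpq, ?_⟩)
      rw [hq]; exact he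
  have hdelay : ∀ j : Fin (n + 1), 0 ≤ ρ.delay j + delayShift B.seq ε j := by
    intro j
    refine Fin.cases ?_ (fun k => ?_) j
    · rw [delayShift_zero]
      linarith [hmv0 0]
    · rw [delayShift_succ]
      by_cases hk : k ∈ B.seq
      · rw [moved_mem hk]
        have := hε1 _ _ (hafter k hk)
        rw [time_succ] at this
        linarith [hmv0 k.succ]
      · rw [moved_not_mem hk]
        linarith [hmv0 k.succ, ρ.delay_nonneg k.succ]
  have htimeout : ∀ k x l c, ρ.act k = TAction.timeout x → ρ.LastUpdate k.castSucc x l c →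
      (l ∈ B.seq ↔ k ∈ B.seq) := by
    intro k x l c ha hl
    have := ρ.triggers_iff.2 ⟨x, c, hl, ha⟩
    exact ⟨fun h => B.mem_of_triggers h this, fun h => B.mem_of_triggered h this⟩
  have hval : ∀ j x k c, ρ.LastUpdate j x k c → x ∈ A.active (ρ.pre j).state →
      (0 : ℝ) ≤ (c : ℕ) + (ρ.time k.castSucc + moved B.seq ε k.castSucc) -
        (ρ.time j + moved B.seq ε j) := by
    intro j x k c hl hx
    have hnn := hl.nonneg hx
    by_cases hj : ∃ p ∈ B.seq, p.castSucc = j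
    · obtain ⟨p, hp, rfl⟩ := hj
      by_cases hk : k ∈ B.seq
      · rw [moved_mem hp, moved_mem hk]
        linarith
      · rw [moved_mem hp, moved_not_mem hk]
        rcases hnn.lt_or_eq with hpos | hzero
        · linarith [hε2 k _ x c hl.2.1 hpos]
        · exfalso
          have hact : ρ.act p ≠ TAction.timeout x := fun ha => hk ((htimeout p x k c ha hl).2 hp)
          by_cases hd : ρ.DiscardsAt p x
          · exact hout p hp k (Or.inr ⟨x, c, hl, hd, (val_eq_zero_iff hl hd).2 hzero.symm⟩)
          · have hnu : ∀ c', ρ.upd p ≠ some (x, c') := fun c' hc =>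
              hd (ρ.discardsAt_iff.2 ⟨hx, hact, Or.inr ⟨c', hc⟩⟩)
            have hx' : x ∈ A.active (ρ.pre p.succ).state := by
              by_contra hc
              exact hd (ρ.discardsAt_iff.2 ⟨hx, hact, Or.inl hc⟩)
            have := (hl.succ hnu).nonneg hx'
            linarith [hafter p hp]
    · have : moved B.seq ε j = 0 := if_neg hj
      linarith [hmv0 k.castSucc]
  obtain ⟨ρ', hu, hd⟩ := ρ.exists_retime (fun j => ρ.delay j + delayShift B.seq ε j)
    (fun j => ρ.time j + moved B.seq ε j) hdelay
    (fun k => by simp only [time_succ, delayShift_succ]; ring) hval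
    (fun k x l c ha hl => by
      have h1 := hl.val (ρ.mem_active_of_timeout ha)
      rw [(ρ.act_step k).2.1 x ha, Option.some_inj] at h1
      by_cases hk : k ∈ B.seq
      · rw [moved_mem hk, moved_mem ((htimeout k x l c ha hl).2 hk)]
        linarith
      · rw [moved_not_mem hk, moved_not_mem (mt (htimeout k x l c ha hl).1 hk)]
        linarith)
  have hd' : ∀ j, ρ'.delay j = ρ.delay j + delayShift B.seq ε j := fun j => by rw [hd]
  have ht := time_of_delayShift hd'
  have hout' : ∀ p ∈ B.seq, ∀ q, ¬ ρ'.Edge p q := by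
    intro p hp q he
    have hq : q ∉ B.seq := by
      have hm : ρ.SameBlock p q → False := by
        intro hs
        obtain ⟨B', hB'⟩ := ρ'.exists_block p
        exact he.not_mem B' hB' (B'.mem_of_sameBlock hB' (hu.sameBlock hs))
      exact fun hq => hm (B.sameBlock hp hq)
    rcases he with ⟨h1, h2⟩ | ⟨x, c, h1, h2, h3⟩
    · rw [ht, ht, moved_mem hp, moved_not_mem hq] at h2
      rcases (ρ.time_mono (Fin.castSucc_le_castSucc_iff.2 h1.le)).lt_or_eq with h | h
      · linarith [hε1 _ _ h]
      · exact hout p hp q (Or.inl ⟨h1, h⟩)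
    · rw [val_eq_zero_iff h1 h2, ht, ht, moved_mem hp, moved_not_mem hq] at h3
      have h1' := hu.symm.lastUpdate h1
      have h2' := hu.symm.discardsAt h2
      rcases (h1'.nonneg (ρ.discardsAt_iff.1 h2').1).lt_or_eq with h | h
      · linarith [hε2 _ _ _ _ h1'.2.1 h]
      · exact hout p hp q (Or.inr ⟨x, c, h1', h2', (val_eq_zero_iff h1' h2').2 h.symm⟩)
  -- For an edge into the block, the gap or timer value has grown by `ε` from a nonnegative number,
  -- so it is no longer zero.
  have hin' : ∀ p ∈ B.seq, ∀ q, ¬ ρ'.Edge q p := by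
    intro p hp q he
    have hq : q ∉ B.seq := fun hq => hout' q hq p he
    rcases he with ⟨h1, h2⟩ | ⟨x, c, h1, h2, h3⟩
    · rw [ht, ht, moved_mem hp, moved_not_mem hq] at h2
      linarith [ρ.time_mono (Fin.castSucc_le_castSucc_iff.2 h1.le)]
    · rw [val_eq_zero_iff h1 h2, ht, ht, moved_mem hp, moved_not_mem hq] at h3
      have h1' := hu.symm.lastUpdate h1
      have h2' := hu.symm.discardsAt h2
      linarith [h1'.nonneg (ρ.discardsAt_iff.1 h2').1]
  have hpad : ρ'.Padded := by
    refine ⟨?_, ?_, fun x hx => ?_⟩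
    · rw [hd', delayShift_zero]
      linarith [hmv0 0]
    · rw [hd']
      rcases n with _ | n
      · rw [show Fin.last 0 = 0 from rfl, delayShift_zero]
        linarith [hmv0 0]
      · rw [← Fin.succ_last, delayShift_succ, Fin.succ_last, moved_last]
        by_cases hk : Fin.last n ∈ B.seq
        · have h1 := hε1 _ _ (hafter _ hk)
          rw [time_succ] at h1
          rw [moved_mem hk, ← Fin.succ_last]
          linarith
        · rw [moved_not_mem hk]
          linarith
    · have hact : x ∈ A.active (ρ'.pre (Fin.last n)).state := by
        rw [← post_state]
        exact ((ρ'.post _).dom x).1 (by simp [hx])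
      obtain ⟨k, c, hk, -⟩ := ρ'.exists_lastUpdate hact
      rw [hk.val hact, Option.some_inj, ht, ht, moved_last] at hx
      have hk' := hu.symm.lastUpdate hk
      rw [← hu.1] at hact
      have h1 := hk'.nonneg hact
      refine hρ2 x ?_
      rw [hk'.val hact, Option.some_inj]
      linarith [hmv0 k.castSucc]
  refine ⟨ρ', ⟨⟨hρ0, hρ1, hρ2⟩, hpad, hu, B, hB, ⟨ε, hε.ne', hd'⟩, fun B' hB' hr => ?_⟩,
    fun p q he => ?_, fun p hp q => ⟨hout' p hp q, hin' p hp q⟩⟩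
  · obtain ⟨p, hp, q, he | he⟩ := inRace_iff.1 hr
    · exact hout' p (hB' ▸ hp) q he
    · exact hin' p (hB' ▸ hp) q he
  · have hp : p ∉ B.seq := fun hp => hout' p hp q he
    have hq : q ∉ B.seq := fun hq => hin' q hq p he
    exact he.of_time_eq hu.symm (time_of_not_mem ht hp).symm (time_of_not_mem ht hq).symm

/-- Induction on the number of edges: acyclicity provides a block with edges but no outgoing ones,
and wiggling it to the right removes its edges, keeps the blocks and adds no edge. -/
theorem wigglable_of_not_cyclic {ρ : TimedRun A n} (hρ : ρ.Padded) (hc : ¬ ρ.Cyclic) :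
    ρ.Wigglable := by
  refine ⟨hρ, ?_⟩
  induction hm : {e : Fin n × Fin n | ρ.Edge e.1 e.2}.ncard using
    Nat.strong_induction_on generalizing ρ with
  | _ m ih =>
    by_cases hf : ∀ p q, ¬ ρ.Edge p q
    · exact ⟨ρ, .refl, raceFree_iff.2 hf⟩
    · push Not at hf
      obtain ⟨p₀, q₀, he₀⟩ := hf
      -- All actions whose block meets an edge. Every target of an edge lies in `S`, so a block that
      -- violates the cycle condition for `S` has no outgoing edge at all.
      let S : Set (Fin n) := {p | ∃ p' q, ρ.SameBlock p p' ∧ (ρ.Edge p' q ∨ ρ.Edge q p')}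
      have hS : ¬ ∀ p ∈ S, ∃ p' q, ρ.SameBlock p p' ∧ ρ.Edge p' q ∧ q ∈ S := fun h =>
        hc ⟨S, ⟨p₀, p₀, q₀, SameBlock.refl _ _, Or.inl he₀⟩, h⟩
      push Not at hS
      obtain ⟨p, ⟨p', q, hb, he⟩, hp⟩ := hS
      obtain ⟨B, hpB⟩ := ρ.exists_block p
      have hp'B := B.mem_of_sameBlock hpB hb
      obtain ⟨ρ', hw, hle, hno⟩ := exists_wiggleBlock hρ B (inRace_iff.2 ⟨p', hp'B, q, he⟩)
        fun r hr q' he' => hp r q' (B.sameBlock hpB hr) he'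
          ⟨q', r, SameBlock.refl _ _, Or.inr he'⟩
      have hc' : ¬ ρ'.Cyclic := by
        rintro ⟨T, hT, h⟩
        refine hc ⟨T, hT, fun r hr => ?_⟩
        obtain ⟨r', s, h1, h2, h3⟩ := h r hr
        exact ⟨r', s, hw.2.2.1.symm.sameBlock h1, hle _ _ h2, h3⟩
      have hlt : {e : Fin n × Fin n | ρ'.Edge e.1 e.2}.ncard < m := by
        rw [← hm]
        refine Set.ncard_lt_ncard ?_ (Set.toFinite _)
        refine ⟨fun e he => hle _ _ he, fun hsub => ?_⟩
        rcases he with he | he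
        · exact (hno p' hp'B q).1 (@hsub (p', q) he)
        · exact (hno p' hp'B q).2 (@hsub (q, p') he)
      obtain ⟨ρ'', h1, h2⟩ := ih _ hlt hw.2.1 hc' rfl
      exact ⟨ρ'', .head hw h1, h2⟩

end TimedRun

end TimerAutomaton

/-! ### Region equivalence is a bisimulation -/

namespace TimerAutomaton

variable {X I Q : Type*} {A : TimerAutomaton X I Q}

theorem Config.isSome_iff {c c' : Config A} (h : c.state = c'.state) (x : X) :
    (c.val x).isSome ↔ (c'.val x).isSome := by rw [c.dom, c'.dom, h]

theorem RegionEquiv.val_zero {c c' : Config A} (h : RegionEquiv c c') {x : X}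
    (hx : c.val x = some 0) : c'.val x = some 0 := by
  obtain ⟨v, hv⟩ := Config.exists_val h.1 hx
  obtain ⟨h1, h2⟩ := h.2.1 x 0 v hx hv
  have h3 := h2.1 (by simp)
  rw [Int.floor_zero] at h1
  rw [hv, ← Int.floor_add_fract v, h3, ← h1]
  simp

theorem RegionEquiv.symm {c c' : Config A} (h : RegionEquiv c c') : RegionEquiv c' c :=
  (regionSetoid A).iseqv.symm h

theorem RegionEquiv.val_zero_iff {c c' : Config A} (h : RegionEquiv c c') {x : X} :
    c.val x = some 0 ↔ c'.val x = some 0 := ⟨h.val_zero, h.symm.val_zero⟩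

theorem RegionEquiv.of_mk_eq {c c' : Config A}
    (h : (Quotient.mk (regionSetoid A) c) = Quotient.mk _ c') : RegionEquiv c c' :=
  Quotient.exact h

theorem Delay.unique {c c₁ c₂ : Config A} {d : ℝ} (h₁ : Delay c d c₁) (h₂ : Delay c d c₂) :
    c₁ = c₂ :=
  Config.ext_val (h₁.2.1.trans h₂.2.1.symm) (by funext x; rw [h₁.2.2.2, h₂.2.2.2])

theorem Delay.exists_of_le {c : Config A} {d : ℝ} (hd : 0 ≤ d)
    (h : ∀ x v, c.val x = some v → d ≤ v) : ∃ c', Delay c d c' :=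
  ⟨{ state := c.state
     val := fun x => (c.val x).map (fun v => v - d)
     dom := fun x => by simpa using c.dom x
     nonneg := fun x v hv => by
      obtain ⟨w, hw, rfl⟩ := Option.map_eq_some_iff.1 hv
      exact sub_nonneg.2 (h x w hw) }, hd, rfl, h, fun _ => rfl⟩

theorem Delay.add {c c₁ c₂ : Config A} {d e : ℝ} (h₁ : Delay c d c₁) (h₂ : Delay c₁ e c₂) :
    Delay c (d + e) c₂ := by
  refine ⟨add_nonneg h₁.1 h₂.1, h₂.2.1.trans h₁.2.1, fun x v hv => ?_, fun x => ?_⟩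
  · have h3 := h₁.2.2.2 x
    rw [hv] at h3
    have := h₂.2.2.1 x _ h3
    linarith
  · rw [h₂.2.2.2, h₁.2.2.2, Option.map_map]
    congr 1
    funext v
    simp
    ring

theorem Delay.refl (c : Config A) : Delay c 0 c :=
  ⟨le_rfl, rfl, fun x v hv => c.nonneg x v hv, fun x => by simp⟩

/-- Two finite families of points of `[0, 1)` with the same order type: each point has a counterpart
with the same position. -/
theorem exists_same_position {ι : Type*} [Finite ι] (g g₀ : ι → ℝ) (h₀ : ∀ i, g₀ i < 1)
    (hle : ∀ i j, g i ≤ g j ↔ g₀ i ≤ g₀ j) (f : ℝ) :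
    ∃ f₀ < 1, ∀ i, (g i ≤ f ↔ g₀ i ≤ f₀) ∧ (f ≤ g i ↔ f₀ ≤ g₀ i) := by
  classical
  have := Fintype.ofFinite ι
  by_cases hf : ∃ j, g j = f
  · obtain ⟨j, rfl⟩ := hf
    exact ⟨g₀ j, h₀ j, fun i => ⟨hle i j, hle j i⟩⟩
  · push Not at hf
    have hlt : ∀ i j, g i < g j ↔ g₀ i < g₀ j := fun i j => by
      rw [← not_le, ← not_le, hle]
    -- If `f` is none of the given points, `f₀` is put strictly between the counterparts of the
    -- points below and above `f`; the extra upper bound 1 keeps it in range.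
    obtain ⟨f₀, h1, h2⟩ := Order.exists_between_finsets
      (lo := (Finset.univ.filter (g · < f)).image g₀)
      (hi := insert 1 ((Finset.univ.filter (f < g ·)).image g₀)) (by
        intro a ha b hb
        simp only [Finset.mem_image, Finset.mem_filter, Finset.mem_univ, true_and,
          Finset.mem_insert] at ha hb
        obtain ⟨i, hi, rfl⟩ := ha
        rcases hb with rfl | ⟨j, hj, rfl⟩
        · exact h₀ i
        · exact (hlt i j).1 (hi.trans hj))
    refine ⟨f₀, h2 1 (by simp), fun i => ?_⟩
    rcases lt_or_gt_of_ne (hf i) with h | h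
    · have h3 : g₀ i < f₀ := h1 _ (Finset.mem_image_of_mem _ (by simpa using h))
      exact ⟨iff_of_true h.le h3.le, iff_of_false h.not_ge h3.not_ge⟩
    · have h3 : f₀ < g₀ i := h2 _ (Finset.mem_insert_of_mem
        (Finset.mem_image_of_mem _ (by simpa using h)))
      exact ⟨iff_of_false h.not_ge h3.not_ge, iff_of_true h.le h3.le⟩

theorem add_le_add_int_iff {a b a' b' : ℝ} (m k : ℤ) (ha : 0 ≤ a) (hb : 0 ≤ b) (ha' : 0 ≤ a')
    (hb' : 0 ≤ b') (ha1 : a < 1) (hb1 : b < 1) (ha1' : a' < 1) (hb1' : b' < 1)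
    (h : a ≤ b ↔ a' ≤ b') : m + a ≤ k + b ↔ m + a' ≤ k + b' := by
  rcases lt_trichotomy m k with hmk | hmk | hmk
  · have : (m : ℝ) + 1 ≤ k := by exact_mod_cast hmk
    exact iff_of_true (by linarith) (by linarith)
  · subst hmk
    simpa using h
  · have : (k : ℝ) + 1 ≤ m := by exact_mod_cast hmk
    exact iff_of_false (by linarith) (by linarith)

/-- A delay has a counterpart from any equivalent configuration. -/
theorem exists_matching_delay [Finite X] {c c₀ : Config A} (h : RegionEquiv c c₀) {d : ℝ}
    (hd : 0 < d) :
    ∃ d₀ > 0, ∀ x v v₀, c.val x = some v → c₀.val x = some v₀ → ∀ k : ℤ,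
      (v ≤ d + k ↔ v₀ ≤ d₀ + k) ∧ (d + k ≤ v ↔ d₀ + k ≤ v₀) := by
  -- The index `none` adds the point 0 to the fractional parts, so that the order also records which
  -- parts vanish. Inactive timers get the default 0.
  let g : Config A → Option X → ℝ := fun c i =>
    i.elim 0 fun x => (c.val x).elim 0 Int.fract
  have hg : ∀ c i, 0 ≤ g c i ∧ g c i < 1 := by
    rintro c (_ | x)
    · simp [g]
    · rcases hv : c.val x with _ | v
      · simp [g, hv]
      · simp [g, hv, Int.fract_nonneg, Int.fract_lt_one]
  have hnone : ∀ {x}, c.val x = none → c₀.val x = none := by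
    intro x hx
    have := Config.isSome_iff h.1 x
    rw [hx] at this
    simpa using this
  have hzero : ∀ i, g c i = 0 ↔ g c₀ i = 0 := by
    rintro (_ | x)
    · simp [g]
    · rcases hv : c.val x with _ | v
      · simp [g, hv, hnone hv]
      · obtain ⟨v₀, hv₀⟩ := Config.exists_val h.1 hv
        simpa [g, hv, hv₀] using (h.2.1 x v v₀ hv hv₀).2
  have hle : ∀ i j, g c i ≤ g c j ↔ g c₀ i ≤ g c₀ j := by
    have hz : ∀ i, g c i = 0 → ∀ j, (g c i ≤ g c j ↔ g c₀ i ≤ g c₀ j) := fun i hi j => by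
      rw [hi, (hzero i).1 hi]
      exact iff_of_true (hg _ _).1 (hg _ _).1
    have hz' : ∀ j, g c j = 0 → ∀ i, (g c i ≤ g c j ↔ g c₀ i ≤ g c₀ j) := fun j hj i => by
      rw [hj, (hzero j).1 hj, (hg _ _).1.ge_iff_eq', (hg _ _).1.ge_iff_eq', hzero]
    rintro (_ | x) (_ | y)
    · simp [g]
    · exact hz _ rfl _
    · exact hz' _ rfl _
    · rcases hv : c.val x with _ | v
      · exact hz _ (by simp [g, hv]) _
      · rcases hw : c.val y with _ | w
        · exact hz' _ (by simp [g, hw]) _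
        · obtain ⟨v₀, hv₀⟩ := Config.exists_val h.1 hv
          obtain ⟨w₀, hw₀⟩ := Config.exists_val h.1 hw
          simpa [g, hv, hv₀, hw, hw₀] using h.2.2 x y v v₀ w w₀ hv hv₀ hw hw₀
  obtain ⟨f₀, hf1, hf⟩ := exists_same_position (g c) (g c₀) (fun i => (hg _ i).2) hle (Int.fract d)
  have hf0 : 0 ≤ f₀ := ((hf none).1).1 (Int.fract_nonneg d)
  have hfl : (0 : ℝ) ≤ ⌊d⌋ := by exact_mod_cast Int.floor_nonneg.2 hd.le
  have hdd := Int.floor_add_fract d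
  have hd0 := Int.fract_nonneg d
  have hd1 := Int.fract_lt_one d
  -- Same integer part as `d`, and a fractional part in the same position among those of `c₀` as
  -- that of `d` among those of `c`.
  refine ⟨⌊d⌋ + f₀, ?_, ?_⟩
  · rcases hfl.lt_or_eq with h1 | h1
    · linarith
    · have h2 : ¬ Int.fract d ≤ 0 := by linarith
      have h3 : ¬ f₀ ≤ 0 := mt ((hf none).2).2 h2
      linarith
  · intro x v v₀ hv hv₀ k
    have h1 : ⌊v⌋ = ⌊v₀⌋ := (h.2.1 x v v₀ hv hv₀).1
    have h2 := hf (some x)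
    simp only [g, Option.elim_some, hv, hv₀] at h2
    have e1 := add_le_add_int_iff ⌊v⌋ (⌊d⌋ + k) (Int.fract_nonneg v) hd0 (Int.fract_nonneg v₀)
      hf0 (Int.fract_lt_one v) hd1 (Int.fract_lt_one v₀) hf1 h2.1
    have e2 := add_le_add_int_iff (⌊d⌋ + k) ⌊v⌋ hd0 (Int.fract_nonneg v) hf0
      (Int.fract_nonneg v₀) hd1 (Int.fract_lt_one v) hf1 (Int.fract_lt_one v₀) h2.2
    rw [Int.floor_add_fract] at e1 e2
    rw [h1, Int.floor_add_fract] at e1 e2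
    push_cast at e1 e2
    have a1 : (⌊d⌋ : ℝ) + k + Int.fract d = d + k := by linarith
    have a2 : (⌊d⌋ : ℝ) + k + f₀ = ⌊d⌋ + f₀ + k := by ring
    rw [a1, a2] at e1 e2
    exact ⟨e1, e2⟩

/-- All comparisons of a value with `d + k`, `k` an integer, agree on both sides. They determine the
integer part after the delay and whether the value is an integer; the cyclic order of fractional
parts is inherited from before the delay. -/
theorem RegionEquiv.exists_delay [Finite X] {c c₀ e : Config A} (h : RegionEquiv c c₀) {d : ℝ}
    (hd : 0 < d) (hde : Delay c d e) : ∃ d₀ > 0, ∃ e₀, Delay c₀ d₀ e₀ ∧ RegionEquiv e e₀ := by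
  obtain ⟨d₀, hd₀, hm⟩ := exists_matching_delay h hd
  obtain ⟨e₀, he₀⟩ := Delay.exists_of_le (c := c₀) hd₀.le fun x v₀ hv₀ => by
    obtain ⟨v, hv⟩ := Config.exists_val h.1.symm hv₀
    have := ((hm x v v₀ hv hv₀ 0).2).1 (by simpa using hde.2.2.1 x v hv)
    simpa using this
  have key : ∀ {x w w₀}, e.val x = some w → e₀.val x = some w₀ →
      ∃ v v₀, c.val x = some v ∧ c₀.val x = some v₀ ∧ w = v - d ∧ w₀ = v₀ - d₀ := by
    intro x w w₀ hw hw₀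
    rw [hde.2.2.2] at hw
    rw [he₀.2.2.2] at hw₀
    obtain ⟨v, hv, rfl⟩ := Option.map_eq_some_iff.1 hw
    obtain ⟨v₀, hv₀, rfl⟩ := Option.map_eq_some_iff.1 hw₀
    exact ⟨v, v₀, hv, hv₀, rfl, rfl⟩
  have hfloor : ∀ {x v v₀}, c.val x = some v → c₀.val x = some v₀ → ⌊v - d⌋ = ⌊v₀ - d₀⌋ := by
    intro x v v₀ hv hv₀
    refine eq_of_forall_le_iff fun k => ?_
    rw [Int.le_floor, Int.le_floor, le_sub_iff_add_le, le_sub_iff_add_le, add_comm,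
      add_comm (k : ℝ)]
    exact (hm x v v₀ hv hv₀ k).2
  refine ⟨d₀, hd₀, e₀, he₀, hde.2.1.trans (h.1.trans he₀.2.1.symm), ?_, ?_⟩
  · intro x w w₀ hw hw₀
    obtain ⟨v, v₀, hv, hv₀, rfl, rfl⟩ := key hw hw₀
    have hfl := hfloor hv hv₀
    refine ⟨hfl, ?_⟩
    have h1 := (hm x v v₀ hv hv₀ ⌊v - d⌋).1
    rw [Int.fract, Int.fract, ← hfl]
    have h2 := Int.floor_le (v - d)
    have h3 := Int.floor_le (v₀ - d₀)
    rw [← hfl] at h3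
    constructor
    · intro h4
      have := h1.1 (by linarith)
      linarith
    · intro h4
      have := h1.2 (by linarith)
      linarith
  · intro x y w w₀ z z₀ hw hw₀ hz hz₀
    obtain ⟨v, v₀, hv, hv₀, rfl, rfl⟩ := key hw hw₀
    obtain ⟨u, u₀, hu, hu₀, rfl, rfl⟩ := key hz hz₀
    rw [Int.fract, Int.fract, Int.fract, Int.fract, ← hfloor hv hv₀, ← hfloor hu hu₀]
    -- The delay cancels when two fractional parts are compared, which leaves original fractional
    -- parts shifted by integers.
    have h1 : ∀ a b d : ℝ, ∀ m k : ℤ, a - d - m ≤ b - d - k ↔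
        ((⌊a⌋ - m : ℤ) : ℝ) + Int.fract a ≤ ((⌊b⌋ - k : ℤ) : ℝ) + Int.fract b := by
      intro a b d m k
      have := Int.floor_add_fract a
      have := Int.floor_add_fract b
      push_cast
      constructor <;> intro <;> linarith
    rw [h1, h1, ← (h.2.1 x v v₀ hv hv₀).1, ← (h.2.1 y u u₀ hu hu₀).1]
    exact add_le_add_int_iff _ _ (Int.fract_nonneg _) (Int.fract_nonneg _) (Int.fract_nonneg _)
      (Int.fract_nonneg _) (Int.fract_lt_one _) (Int.fract_lt_one _) (Int.fract_lt_one _)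
      (Int.fract_lt_one _) (h.2.2 x y v v₀ u u₀ hv hv₀ hu hu₀)

/-- An updated timer gets the same integer on both sides, with fractional part 0, the least
possible; the other timers keep their equivalent values. -/
theorem RegionEquiv.exists_step {c c₀ e : Config A} (h : RegionEquiv c c₀) {a : TAction X I}
    {u : TUpdate X} (hs : Step c a u e) : ∃ e₀, Step c₀ a u e₀ ∧ RegionEquiv e e₀ := by
  classical
  obtain ⟨ht, hto, hv⟩ := hs
  have hact : ∀ y ∈ A.active e.state, (∀ n : ℕ+, u ≠ some (y, n)) → y ∈ A.active c.state := by
    intro y hy hn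
    rw [← c.dom, ← (hv y hy).2 hn]
    exact (e.dom y).2 hy
  let val₀ : X → Option ℝ := fun y =>
    if y ∈ A.active e.state then
      if ∃ n : ℕ+, u = some (y, n) then e.val y else c₀.val y
    else none
  have hval : ∀ y ∈ A.active e.state, ∀ n : ℕ+, u = some (y, n) → val₀ y = some ((n : ℕ) : ℝ) := by
    intro y hy n hn
    have : ∃ n : ℕ+, u = some (y, n) := ⟨n, hn⟩
    simp only [val₀, if_pos hy, if_pos this]
    exact (hv y hy).1 n hn
  have hval' : ∀ y ∈ A.active e.state, (∀ n : ℕ+, u ≠ some (y, n)) → val₀ y = c₀.val y := by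
    intro y hy hn
    have : ¬ ∃ n : ℕ+, u = some (y, n) := fun ⟨n, h⟩ => hn n h
    simp only [val₀, if_pos hy, if_neg this]
  let e₀ : Config A :=
    { state := e.state
      val := val₀
      dom := fun y => by
        by_cases hy : y ∈ A.active e.state
        · by_cases hn : ∃ n : ℕ+, u = some (y, n)
          · obtain ⟨n, hn⟩ := hn
            simp [hval y hy n hn, hy]
          · have hn' : ∀ n : ℕ+, u ≠ some (y, n) := fun n h => hn ⟨n, h⟩
            rw [hval' y hy hn', c₀.dom, ← h.1]
            exact iff_of_true (hact y hy hn') hy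
        · simp [val₀, hy]
      nonneg := fun y v h1 => by
        simp only [val₀] at h1
        split_ifs at h1
        · exact e.nonneg y v h1
        · exact c₀.nonneg y v h1 }
  refine ⟨e₀, ⟨by rw [← h.1]; exact ht, fun x hx => h.val_zero (hto x hx), fun y hy =>
    ⟨hval y hy, hval' y hy⟩⟩, rfl, ?_⟩
  have key : ∀ {y w w₀}, e.val y = some w → e₀.val y = some w₀ →
      (∃ n : ℕ, w = n ∧ w₀ = n) ∨ (c.val y = some w ∧ c₀.val y = some w₀) := by
    intro y w w₀ hw hw₀
    have hy : y ∈ A.active e.state := (e.dom y).1 (by simp [hw])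
    by_cases hn : ∃ n : ℕ+, u = some (y, n)
    · obtain ⟨n, hn⟩ := hn
      rw [(hv y hy).1 n hn] at hw
      change val₀ y = _ at hw₀
      rw [hval y hy n hn] at hw₀
      exact Or.inl ⟨n, (Option.some.inj hw).symm, (Option.some.inj hw₀).symm⟩
    · have hn' : ∀ n : ℕ+, u ≠ some (y, n) := fun n h => hn ⟨n, h⟩
      rw [(hv y hy).2 hn'] at hw
      change val₀ y = _ at hw₀
      rw [hval' y hy hn'] at hw₀
      exact Or.inr ⟨hw, hw₀⟩
  have hone : ∀ {y w w₀}, e.val y = some w → e₀.val y = some w₀ →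
      ⌊w⌋ = ⌊w₀⌋ ∧ (Int.fract w = 0 ↔ Int.fract w₀ = 0) := by
    intro y w w₀ hw hw₀
    rcases key hw hw₀ with ⟨n, rfl, rfl⟩ | ⟨h1, h2⟩
    · simp
    · exact h.2.1 y w w₀ h1 h2
  refine ⟨fun x v v' h1 h2 => hone h1 h2, fun x y v v' w w' h1 h2 h3 h4 => ?_⟩
  have o1 := hone h1 h2
  have o2 := hone h3 h4
  rcases key h1 h2 with ⟨n, rfl, rfl⟩ | ⟨k1, k2⟩
  · simp [Int.fract_nonneg]
  · rcases key h3 h4 with ⟨n, rfl, rfl⟩ | ⟨k3, k4⟩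
    · rw [Int.fract_natCast, (Int.fract_nonneg _).ge_iff_eq', (Int.fract_nonneg _).ge_iff_eq']
      exact o1.2
    · exact h.2.2 x y v v' w w' k1 k2 k3 k4

end TimerAutomaton

/-! ### Timed runs behind region runs -/

namespace TimerAutomaton

variable {X I Q : Type*} {A : TimerAutomaton X I Q}

namespace TimedRun

variable {n : ℕ}

/-- The timed run without actions and without delay. -/
def empty (A : TimerAutomaton X I Q) : TimedRun A 0 where
  pre := fun _ => A.initConfig
  delay := fun _ => 0
  post := fun _ => A.initConfig
  act := Fin.elim0
  upd := Fin.elim0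
  pre_zero := rfl
  delay_step := fun _ => Delay.refl _
  act_step := fun k => k.elim0

/-- Extend the last delay of a timed run. -/
noncomputable def extendDelay (ρ : TimedRun A n) (d : ℝ) (c : Config A)
    (h : Delay (ρ.post (Fin.last n)) d c) : TimedRun A n where
  pre := ρ.pre
  delay := Function.update ρ.delay (Fin.last n) (ρ.delay (Fin.last n) + d)
  post := Function.update ρ.post (Fin.last n) c
  act := ρ.act
  upd := ρ.upd
  pre_zero := ρ.pre_zero
  delay_step := fun j => by
    by_cases hj : j = Fin.last n
    · subst hj
      simpa using (ρ.delay_step _).add h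
    · simpa [Function.update_of_ne hj] using ρ.delay_step j
  act_step := fun k => by
    rw [Function.update_of_ne (Fin.castSucc_lt_last k).ne]
    exact ρ.act_step k

/-- Append an action to a timed run. -/
noncomputable def appendAct (ρ : TimedRun A n) (a : TAction X I) (u : TUpdate X) (c : Config A)
    (h : Step (ρ.post (Fin.last n)) a u c) : TimedRun A (n + 1) where
  pre := Fin.snoc (α := fun _ => Config A) ρ.pre c
  delay := Fin.snoc (α := fun _ => ℝ) ρ.delay 0
  post := Fin.snoc (α := fun _ => Config A) ρ.post c
  act := Fin.snoc (α := fun _ => TAction X I) ρ.act a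
  upd := Fin.snoc (α := fun _ => TUpdate X) ρ.upd u
  pre_zero := by
    rw [← Fin.castSucc_zero, Fin.snoc_castSucc]
    exact ρ.pre_zero
  delay_step := fun j => by
    refine Fin.lastCases ?_ (fun j => ?_) j
    · simp only [Fin.snoc_last]
      exact Delay.refl c
    · simp only [Fin.snoc_castSucc]
      exact ρ.delay_step j
  act_step := fun k => by
    refine Fin.lastCases ?_ (fun k => ?_) k
    · simp only [Fin.succ_last, Fin.snoc_last, Fin.snoc_castSucc]
      exact h
    · simp only [Fin.succ_castSucc, Fin.snoc_castSucc]
      exact ρ.act_step k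

end TimedRun

namespace RegionRun

variable {m n : ℕ} {w : Fin m → RegionLetter X I}

/-- The run `r` follows the timed run `ρ`: as for `Represents`, but timers may be pending at the
end. -/
structure Tracks (r : RegionRun A w) (ρ : TimedRun A n) (pos : Fin (m + 1) → Fin (n + 1))
    (wait : Fin (m + 1) → ℝ) : Prop where
  pos_zero : pos 0 = 0
  wait_zero : wait 0 = 0
  region : ∀ j, ∃ c, Delay (ρ.pre (pos j)) (wait j) c ∧ (r.state j).region = Quotient.mk _ c
  tau : ∀ j : Fin m, w j = RegionLetter.tau →
    pos j.succ = pos j.castSucc ∧ wait j.castSucc < wait j.succ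
  act : ∀ (j : Fin m) (a : TAction X I) (x : Option X), w j = RegionLetter.act a x →
    ∃ k : Fin n, pos j.castSucc = k.castSucc ∧ pos j.succ = k.succ ∧ ρ.act k = a ∧
      wait j.castSucc = ρ.delay k.castSucc ∧ wait j.succ = 0
  kill : ∀ (j : Fin m) (x : X), w j = RegionLetter.kill x →
    pos j.succ = pos j.castSucc ∧ wait j.succ = wait j.castSucc
  pos_last : pos (Fin.last m) = Fin.last n
  wait_last : wait (Fin.last m) = ρ.delay (Fin.last n)

theorem represents_iff {r : RegionRun A w} {ρ : TimedRun A n} :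
    r.Represents ρ ↔ (∃ pos wait, r.Tracks ρ pos wait) ∧ (r.state (Fin.last m)).pending = ∅ := by
  constructor
  · rintro ⟨pos, wait, h1, h2, h3, h4, h5, h6, h7, h8, h9⟩
    exact ⟨⟨pos, wait, h1, h2, h3, h4, h5, h6, h7, h8⟩, h9⟩
  · rintro ⟨⟨pos, wait, h1, h2, h3, h4, h5, h6, h7, h8⟩, h9⟩
    exact ⟨pos, wait, h1, h2, h3, h4, h5, h6, h7, h8, h9⟩

/-- The run without its last transition. -/
def init {w : Fin (m + 1) → RegionLetter X I} (r : RegionRun A w) :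
    RegionRun A (fun j => w j.castSucc) where
  state := fun j => r.state j.castSucc
  state_zero := r.state_zero
  step := fun j => r.step j.castSucc

/-- By the bisimulation, the timed run is built letter by letter from its actual last configuration:
`tau` prolongs the last delay, an action is appended with a zero delay after it, and `kill` changes
nothing. -/
theorem exists_tracks [Finite X] {m : ℕ} {w : Fin m → RegionLetter X I} (r : RegionRun A w) :
    ∃ (n : ℕ) (ρ : TimedRun A n) (pos : _) (wait : _), r.Tracks ρ pos wait := by
  induction m with
  | zero =>
    refine ⟨0, TimedRun.empty A, fun _ => 0, fun _ => 0, rfl, rfl, fun j => ?_, fun j => j.elim0,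
      fun j => j.elim0, fun j => j.elim0, rfl, rfl⟩
    refine ⟨A.initConfig, Delay.refl _, ?_⟩
    rw [show j = 0 from Fin.ext (by omega), r.state_zero]
    rfl
  | succ m ih =>
    obtain ⟨n, ρ, pos, wait, h⟩ := ih r.init
    have hpost : (r.state (Fin.last m).castSucc).region =
        Quotient.mk _ (ρ.post (Fin.last n)) := by
      obtain ⟨c, h1, h2⟩ := h.region (Fin.last m)
      rw [h.pos_last, h.wait_last] at h1
      rw [h1.unique (ρ.delay_step _)] at h2
      exact h2
    have hstep := r.step (Fin.last m)
    cases hw : w (Fin.last m) with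
    | tau =>
      rw [hw] at hstep
      obtain ⟨-, -, c, c', d, hc, hc', hd, hcd⟩ := hstep
      obtain ⟨d₀, hd₀, e₀, he₀, heq⟩ :=
        (RegionEquiv.of_mk_eq (hc.symm.trans hpost)).exists_delay hd hcd
      have hdel : ∀ k : Fin n, (ρ.extendDelay d₀ e₀ he₀).delay k.castSucc = ρ.delay k.castSucc :=
        fun k => Function.update_of_ne (Fin.castSucc_lt_last k).ne _ _
      refine ⟨n, ρ.extendDelay d₀ e₀ he₀, Fin.snoc (α := fun _ => Fin (n + 1)) pos (Fin.last n),
        Fin.snoc (α := fun _ => ℝ) wait (ρ.delay (Fin.last n) + d₀), ?_, ?_, ?_, ?_, ?_, ?_, ?_, ?_⟩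
      · rw [← Fin.castSucc_zero, Fin.snoc_castSucc, h.pos_zero]
      · rw [← Fin.castSucc_zero, Fin.snoc_castSucc, h.wait_zero]
      · intro j
        refine Fin.lastCases ?_ (fun j => ?_) j
        · simp only [Fin.snoc_last]
          refine ⟨e₀, (ρ.delay_step _).add he₀, ?_⟩
          rw [← Fin.succ_last, hc']
          exact Quotient.sound heq
        · simp only [Fin.snoc_castSucc]
          exact h.region j
      · intro j
        refine Fin.lastCases (fun _ => ?_) (fun j hj => ?_) j
        · simp only [Fin.succ_last, Fin.snoc_last, Fin.snoc_castSucc, h.pos_last, h.wait_last]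
          exact ⟨trivial, by linarith⟩
        · simp only [Fin.succ_castSucc, Fin.snoc_castSucc]
          exact h.tau j hj
      · intro j a x
        refine Fin.lastCases (fun hj => ?_) (fun j hj => ?_) j
        · rw [hw] at hj; cases hj
        · simp only [Fin.succ_castSucc, Fin.snoc_castSucc, hdel]
          exact h.act j a x hj
      · intro j x
        refine Fin.lastCases (fun hj => ?_) (fun j hj => ?_) j
        · rw [hw] at hj; cases hj
        · simp only [Fin.succ_castSucc, Fin.snoc_castSucc]
          exact h.kill j x hj
      · simp only [Fin.snoc_last]
      · simp [TimedRun.extendDelay]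
    | act a y =>
      rw [hw] at hstep
      obtain ⟨-, c, c', u, hc, hc', hs, -, -⟩ := hstep
      obtain ⟨e₀, he₀, heq⟩ := (RegionEquiv.of_mk_eq (hc.symm.trans hpost)).exists_step hs
      refine ⟨n + 1, ρ.appendAct a u e₀ he₀,
        Fin.snoc (α := fun _ => Fin (n + 2)) (fun j => (pos j).castSucc) (Fin.last (n + 1)),
        Fin.snoc (α := fun _ => ℝ) wait 0, ?_, ?_, ?_, ?_, ?_, ?_, ?_, ?_⟩
      · rw [← Fin.castSucc_zero, Fin.snoc_castSucc, h.pos_zero, Fin.castSucc_zero]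
      · rw [← Fin.castSucc_zero, Fin.snoc_castSucc, h.wait_zero]
      · intro j
        refine Fin.lastCases ?_ (fun j => ?_) j
        · simp only [Fin.snoc_last, TimedRun.appendAct]
          refine ⟨e₀, Delay.refl _, ?_⟩
          rw [← Fin.succ_last, hc']
          exact Quotient.sound heq
        · simp only [Fin.snoc_castSucc, TimedRun.appendAct]
          exact h.region j
      · intro j
        refine Fin.lastCases (fun hj => ?_) (fun j hj => ?_) j
        · rw [hw] at hj; cases hj
        · simp only [Fin.succ_castSucc, Fin.snoc_castSucc]
          obtain ⟨h1, h2⟩ := h.tau j hj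
          exact ⟨by rw [h1], h2⟩
      · intro j b x
        refine Fin.lastCases (fun hj => ?_) (fun j hj => ?_) j
        · rw [hw] at hj
          obtain ⟨rfl, -⟩ := RegionLetter.act.inj hj
          refine ⟨Fin.last n, ?_⟩
          simp [Fin.succ_last, TimedRun.appendAct, h.pos_last, h.wait_last]
        · obtain ⟨k, h1, h2, h3, h4, h5⟩ := h.act j b x hj
          refine ⟨k.castSucc, ?_⟩
          simp only [Fin.succ_castSucc, Fin.snoc_castSucc, TimedRun.appendAct, h1, h2, h3, h4, h5,
            and_self]
      · intro j x
        refine Fin.lastCases (fun hj => ?_) (fun j hj => ?_) j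
        · rw [hw] at hj; cases hj
        · simp only [Fin.succ_castSucc, Fin.snoc_castSucc]
          obtain ⟨h1, h2⟩ := h.kill j x hj
          exact ⟨by rw [h1], h2⟩
      · simp only [Fin.snoc_last]
      · simp [TimedRun.appendAct]
    | kill y =>
      rw [hw] at hstep
      obtain ⟨-, hreg, -⟩ := hstep
      refine ⟨n, ρ, Fin.snoc (α := fun _ => Fin (n + 1)) pos (Fin.last n),
        Fin.snoc (α := fun _ => ℝ) wait (ρ.delay (Fin.last n)), ?_, ?_, ?_, ?_, ?_, ?_, ?_, ?_⟩
      · rw [← Fin.castSucc_zero, Fin.snoc_castSucc, h.pos_zero]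
      · rw [← Fin.castSucc_zero, Fin.snoc_castSucc, h.wait_zero]
      · intro j
        refine Fin.lastCases ?_ (fun j => ?_) j
        · simp only [Fin.snoc_last]
          refine ⟨_, ρ.delay_step _, ?_⟩
          rw [← Fin.succ_last, hreg, hpost]
        · simp only [Fin.snoc_castSucc]
          exact h.region j
      · intro j
        refine Fin.lastCases (fun hj => ?_) (fun j hj => ?_) j
        · rw [hw] at hj; cases hj
        · simp only [Fin.succ_castSucc, Fin.snoc_castSucc]
          exact h.tau j hj
      · intro j a x
        refine Fin.lastCases (fun hj => ?_) (fun j hj => ?_) j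
        · rw [hw] at hj; cases hj
        · simp only [Fin.succ_castSucc, Fin.snoc_castSucc]
          exact h.act j a x hj
      · intro j x
        refine Fin.lastCases (fun _ => ?_) (fun j hj => ?_) j
        · simp only [Fin.succ_last, Fin.snoc_last, Fin.snoc_castSucc, h.pos_last, h.wait_last]
          exact ⟨trivial, trivial⟩
        · simp only [Fin.succ_castSucc, Fin.snoc_castSucc]
          exact h.kill j x hj
      · simp only [Fin.snoc_last]
      · simp only [Fin.snoc_last]

/-- The last transition of the run, a delay, can be shortened so that no timer is zero at the
end. -/
theorem exists_noZeroAtEnd {w : Fin (m + 1) → RegionLetter X I} (r : RegionRun A w)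
    (hw : w (Fin.last m) = RegionLetter.tau) : ∃ r' : RegionRun A w, r'.NoZeroAtEnd := by
  have hstep := r.step (Fin.last m)
  rw [hw] at hstep
  obtain ⟨hp, -, c, c', d, hc, -, hd, hcd⟩ := hstep
  -- Timers that survive the delay `d` still have value at least `d / 2` after half of it, and the
  -- label is unchanged.
  obtain ⟨e, he⟩ := Delay.exists_of_le (c := c) (d := d / 2) (by linarith) fun x v hv => by
    linarith [hcd.2.2.1 x v hv]
  refine ⟨⟨Function.update r.state (Fin.last (m + 1)) ⟨Quotient.mk _ e, ∅⟩, ?_, ?_⟩, ?_⟩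
  · rw [Function.update_of_ne (Fin.last_pos).ne]
    exact r.state_zero
  · intro j
    rw [Function.update_of_ne (Fin.castSucc_lt_last j).ne]
    refine Fin.lastCases ?_ (fun j => ?_) j
    · rw [Fin.succ_last, Function.update_self, hw]
      exact ⟨hp, rfl, c, e, d / 2, hc, rfl, by linarith, he⟩
    · rw [Fin.succ_castSucc, Function.update_of_ne (Fin.castSucc_lt_last _).ne]
      exact r.step j.castSucc
  · intro c' hc' x hx
    simp only [Function.update_self] at hc'
    have h0 := (RegionEquiv.of_mk_eq hc').val_zero_iff.2 hx
    rw [he.2.2.2] at h0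
    obtain ⟨v, hv, hv'⟩ := Option.map_eq_some_iff.1 h0
    linarith [hcd.2.2.1 x v hv]

end RegionRun

end TimerAutomaton

/-! ### Letters that update or time out a timer -/

namespace RegionLetter

variable {X I : Type*}

/-- The letter is an action that updates the timer `x`. -/
def Updates (a : RegionLetter X I) (x : X) : Prop :=
  (∃ i, a = act (TAction.input i) (some x)) ∨ a = act (TAction.timeout x) (some x)

/-- The letter is a timeout of the timer `x`. -/
def TimesOut (a : RegionLetter X I) (x : X) : Prop :=
  a = act (TAction.timeout x) none ∨ a = act (TAction.timeout x) (some x)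

theorem Updates.unique {a : RegionLetter X I} {x y : X} (hx : a.Updates x) (hy : a.Updates y) :
    x = y := by
  rcases hx with ⟨i, rfl⟩ | rfl <;> rcases hy with ⟨j, hy⟩ | hy <;> simp at hy
  exacts [hy.2, hy]

/-- The letter is an action. -/
def IsAct (a : RegionLetter X I) : Prop := ¬ (a = tau ∨ ∃ x, a = kill x)

theorem isAct_iff {a : RegionLetter X I} : a.IsAct ↔ ∃ b x, a = act b x := by
  cases a <;> simp [IsAct]

theorem Updates.isAct {a : RegionLetter X I} {x : X} (h : a.Updates x) : a.IsAct := by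
  rcases h with ⟨i, rfl⟩ | rfl <;> simp [IsAct]

theorem TimesOut.isAct {a : RegionLetter X I} {x : X} (h : a.TimesOut x) : a.IsAct := by
  rcases h with rfl | rfl <;> simp [IsAct]

end RegionLetter

/-! ### Reading triggers and edges off the word -/

namespace TimerAutomaton

variable {X I Q : Type*} {A : TimerAutomaton X I Q}

namespace RegionRun

open RegionLetter TimedRun

variable {m n : ℕ} {w : Fin m → RegionLetter X I} {r : RegionRun A w} {ρ : TimedRun A n}
  {pos : Fin (m + 1) → Fin (n + 1)} {wait : Fin (m + 1) → ℝ}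

/-- The letter `j` of the word is the action `k` of the timed run. -/
def ActAt (pos : Fin (m + 1) → Fin (n + 1)) (j : Fin m) (k : Fin n) : Prop :=
  pos j.castSucc = k.castSucc ∧ pos j.succ = k.succ

theorem ActAt.unique {j : Fin m} {k k' : Fin n} (h : ActAt pos j k) (h' : ActAt pos j k') :
    k = k' := Fin.castSucc_injective _ (h.1.symm.trans h'.1)

namespace Tracks

theorem exists_actAt (h : r.Tracks ρ pos wait) {j : Fin m} (hj : (w j).IsAct) :
    ∃ k, ActAt pos j k := by
  obtain ⟨a, x, hw⟩ := isAct_iff.1 hj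
  obtain ⟨k, h1, h2, -⟩ := h.act j a x hw
  exact ⟨k, h1, h2⟩

theorem isAct (h : r.Tracks ρ pos wait) {j : Fin m} (hj : pos j.succ ≠ pos j.castSucc) :
    (w j).IsAct := by
  rintro (hw | ⟨x, hw⟩)
  · exact hj (h.tau j hw).1
  · exact hj (h.kill j x hw).1

theorem isAct_of_actAt (h : r.Tracks ρ pos wait) {j : Fin m} {k : Fin n} (hj : ActAt pos j k) :
    (w j).IsAct := by
  refine h.isAct ?_
  rw [hj.1, hj.2]
  exact Fin.castSucc_lt_succ.ne'

theorem pos_mono (h : r.Tracks ρ pos wait) : Monotone pos := by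
  refine Fin.monotone_iff_le_succ.2 fun j => ?_
  by_cases hj : pos j.succ = pos j.castSucc
  · exact hj.ge
  · obtain ⟨k, hk⟩ := h.exists_actAt (h.isAct hj)
    rw [hk.1, hk.2]
    exact Fin.castSucc_lt_succ.le

theorem lt_of_lt (h : r.Tracks ρ pos wait) {j j' : Fin m} {k k' : Fin n} (hj : ActAt pos j k)
    (hj' : ActAt pos j' k') (hlt : j < j') : k < k' := by
  have h1 : j.succ ≤ j'.castSucc := Fin.succ_le_castSucc_iff.2 hlt
  have h2 := h.pos_mono h1
  rw [hj.2, hj'.1] at h2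
  exact Fin.succ_le_castSucc_iff.1 h2

theorem lt_iff (h : r.Tracks ρ pos wait) {j j' : Fin m} {k k' : Fin n} (hj : ActAt pos j k)
    (hj' : ActAt pos j' k') : j < j' ↔ k < k' := by
  refine ⟨h.lt_of_lt hj hj', fun hk => ?_⟩
  rcases lt_trichotomy j j' with hl | hl | hl
  · exact hl
  · subst hl
    exact absurd (hj.unique hj') hk.ne
  · exact absurd (h.lt_of_lt hj' hj hl) hk.asymm

theorem actAt_surjective (h : r.Tracks ρ pos wait) (k : Fin n) : ∃ j, ActAt pos j k := by
  have : ∃ j : Fin m, pos j.castSucc ≤ k.castSucc ∧ k.castSucc < pos j.succ := by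
    by_contra hc
    push Not at hc
    have : ∀ j, pos j ≤ k.castSucc := by
      intro j
      induction j using Fin.induction with
      | zero => rw [h.pos_zero]; exact Fin.zero_le _
      | succ j ih => exact hc j ih
    have := this (Fin.last m)
    rw [h.pos_last] at this
    exact absurd (Fin.castSucc_lt_last k) this.not_gt
  obtain ⟨j, h1, h2⟩ := this
  obtain ⟨k', hk'⟩ := h.exists_actAt (h.isAct (h1.trans_lt h2).ne')
  refine ⟨j, ?_⟩
  have : k' = k := by
    rw [hk'.1, Fin.castSucc_le_castSucc_iff] at h1
    rw [hk'.2, Fin.castSucc_lt_succ_iff] at h2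
    exact le_antisymm h1 h2
  exact this ▸ hk'

theorem region_at (h : r.Tracks ρ pos wait) {j : Fin m} {k : Fin n} (hj : ActAt pos j k) :
    (r.state j.castSucc).region = Quotient.mk _ (ρ.post k.castSucc) := by
  obtain ⟨a, x, hw⟩ := isAct_iff.1 (h.isAct_of_actAt hj)
  obtain ⟨k', h1, h2, -, h3, -⟩ := h.act j a x hw
  obtain rfl : k = k' := hj.unique ⟨h1, h2⟩
  obtain ⟨c, h4, h5⟩ := h.region j.castSucc
  rw [hj.1, h3] at h4
  rw [h5, h4.unique (ρ.delay_step _)]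

/-- The region transition may use another representative, but it has the same state, so determinism
gives the same update, and being zero is invariant under equivalence. -/
theorem letter_and_pending (h : r.Tracks ρ pos wait) {j : Fin m} {k : Fin n}
    (hj : ActAt pos j k) : w j = RegionLetter.act (ρ.act k) ((ρ.upd k).map Prod.fst) ∧
      (r.state j.succ).pending =
        {x | ρ.DiscardsAt k x ∧ (ρ.post k.castSucc).val x = some 0} := by
  obtain ⟨a, x, hw⟩ := isAct_iff.1 (h.isAct_of_actAt hj)
  obtain ⟨k', h1, h2, ha, -⟩ := h.act j a x hw
  obtain rfl : k = k' := hj.unique ⟨h1, h2⟩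
  have hstep := r.step j
  rw [hw] at hstep
  obtain ⟨-, c, c', u, hc, -, hs, hx, hp⟩ := hstep
  have heq := RegionEquiv.of_mk_eq (hc.symm.trans (h.region_at hj))
  have ht := (ρ.act_step k).1
  rw [← heq.1, ha, hs.1] at ht
  simp only [Option.some.injEq, Prod.mk.injEq] at ht
  refine ⟨by rw [hw, ha, hx, ht.2], ?_⟩
  rw [hp]
  ext y
  simp only [Set.mem_ofPred_eq, DiscardsAt, ← heq.1, ha, ← ht.1, ← ht.2, heq.val_zero_iff]

theorem letter_at (h : r.Tracks ρ pos wait) {j : Fin m} {k : Fin n} (hj : ActAt pos j k) :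
    w j = RegionLetter.act (ρ.act k) ((ρ.upd k).map Prod.fst) := (h.letter_and_pending hj).1

theorem pending_at (h : r.Tracks ρ pos wait) {j : Fin m} {k : Fin n} (hj : ActAt pos j k) :
    (r.state j.succ).pending = {x | ρ.DiscardsAt k x ∧ (ρ.post k.castSucc).val x = some 0} :=
  (h.letter_and_pending hj).2

/-! Delays -/

theorem wait_nonneg (h : r.Tracks ρ pos wait) (j : Fin (m + 1)) : 0 ≤ wait j := by
  obtain ⟨c, hc, -⟩ := h.region j
  exact hc.1

theorem wait_le (h : r.Tracks ρ pos wait) (j : Fin (m + 1)) : wait j ≤ ρ.delay (pos j) := by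
  induction j using Fin.reverseInduction with
  | last => rw [h.wait_last, h.pos_last]
  | cast j ih =>
    cases hw : w j with
    | tau =>
      obtain ⟨h1, h2⟩ := h.tau j hw
      rw [h1] at ih
      linarith
    | act a x =>
      obtain ⟨k, h1, -, -, h2, -⟩ := h.act j a x hw
      rw [h1, h2]
    | kill x =>
      obtain ⟨h1, h2⟩ := h.kill j x hw
      rwa [h1, h2] at ih

/-- Timers become pending only through an action, and until they are all killed no delay can occur.
-/
theorem wait_eq_zero_of_pending (h : r.Tracks ρ pos wait) (j : Fin (m + 1)) :
    (r.state j).pending.Nonempty → wait j = 0 := by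
  induction j using Fin.induction with
  | zero => exact fun _ => h.wait_zero
  | succ j ih =>
    intro hne
    have hstep := r.step j
    cases hw : w j with
    | tau =>
      rw [hw] at hstep
      exact absurd hstep.2.1 hne.ne_empty
    | act a x => exact (h.act j a x hw).choose_spec.2.2.2.2
    | kill x =>
      rw [hw] at hstep
      rw [(h.kill j x hw).2]
      exact ih ⟨x, hstep.1⟩

/-- A run cannot start with `kill`, since nothing is pending, and starting with an action means that
the first delay is zero. -/
theorem first_delay_pos (h : r.Tracks ρ pos wait) :
    0 < ρ.delay 0 ↔ ∃ f : Fin m, (∀ i, ¬ i < f) ∧ w f = RegionLetter.tau := by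
  constructor
  · intro hd
    rcases m with _ | m
    · have h1 := h.wait_last
      rw [← h.pos_last, show Fin.last 0 = 0 from rfl, h.wait_zero, h.pos_zero] at h1
      exact absurd h1 hd.ne
    · refine ⟨0, fun i => by simp, ?_⟩
      cases hw : w 0 with
      | tau => rfl
      | act a x =>
        obtain ⟨k, h1, -, -, h2, -⟩ := h.act 0 a x hw
        rw [Fin.castSucc_zero, h.pos_zero] at h1
        rw [Fin.castSucc_zero, h.wait_zero, ← h1] at h2
        exact absurd h2 hd.ne
      | kill x =>
        have hstep := r.step 0
        rw [hw, Fin.castSucc_zero, r.state_zero] at hstep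
        exact absurd hstep.1 (Set.notMem_empty x)
  · rintro ⟨f, hf, hw⟩
    obtain ⟨h1, h2⟩ := h.tau f hw
    have hf0 : f.castSucc = 0 := by
      rcases m with _ | m
      · exact f.elim0
      · have := hf 0
        rw [Fin.pos_iff_ne_zero, not_not] at this
        rw [this, Fin.castSucc_zero]
    have h3 := h.wait_le f.succ
    rw [h1, hf0, h.pos_zero] at h3
    rw [hf0, h.wait_zero] at h2
    linarith

theorem last_delay_pos (h : r.Tracks ρ pos wait) :
    0 < ρ.delay (Fin.last n) ↔ ∃ l : Fin m, (∀ i, ¬ l < i) ∧ w l = RegionLetter.tau := by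
  constructor
  · intro hd
    rcases m with _ | m
    · have h1 := h.wait_last
      rw [show Fin.last 0 = 0 from rfl, h.wait_zero] at h1
      exact absurd h1 hd.ne
    · refine ⟨Fin.last m, fun i => (Fin.le_last i).not_gt, ?_⟩
      cases hw : w (Fin.last m) with
      | tau => rfl
      | act a x =>
        obtain ⟨k, -, -, -, -, h1⟩ := h.act _ a x hw
        rw [Fin.succ_last, h.wait_last] at h1
        exact absurd h1 hd.ne'
      | kill x =>
        have hstep := r.step (Fin.last m)
        rw [hw] at hstep
        have h1 := (h.kill _ x hw).2
        rw [h.wait_eq_zero_of_pending _ ⟨x, hstep.1⟩, Fin.succ_last, h.wait_last] at h1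
        exact absurd h1 hd.ne'
  · rintro ⟨l, hl, hw⟩
    obtain ⟨h1, h2⟩ := h.tau l hw
    have hl' : l.succ = Fin.last m := by
      rcases m with _ | m
      · exact l.elim0
      · rw [← Fin.succ_last, Fin.succ_inj]
        exact le_antisymm (Fin.le_last _) (not_lt.1 (hl (Fin.last m)))
    rw [hl', h.wait_last] at h2
    linarith [h.wait_nonneg l.castSucc]

/-- The absolute time after `j` letters. -/
noncomputable def clock (ρ : TimedRun A n) (pos : Fin (m + 1) → Fin (n + 1))
    (wait : Fin (m + 1) → ℝ) (j : Fin (m + 1)) : ℝ :=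
  ρ.time (pos j) - ρ.delay (pos j) + wait j

theorem clock_tau (h : r.Tracks ρ pos wait) {j : Fin m} (hj : w j = RegionLetter.tau) :
    clock ρ pos wait j.castSucc < clock ρ pos wait j.succ := by
  obtain ⟨h1, h2⟩ := h.tau j hj
  rw [clock, clock, h1]
  linarith

theorem clock_ne_tau (h : r.Tracks ρ pos wait) {j : Fin m} (hj : w j ≠ RegionLetter.tau) :
    clock ρ pos wait j.succ = clock ρ pos wait j.castSucc := by
  cases hw : w j with
  | tau => exact absurd hw hj
  | act a x =>
    obtain ⟨k, h1, h2, -, h3, h4⟩ := h.act j a x hw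
    rw [clock, clock, h1, h2, h3, h4, time_succ]
    ring
  | kill x =>
    obtain ⟨h1, h2⟩ := h.kill j x hw
    rw [clock, clock, h1, h2]

theorem clock_mono (h : r.Tracks ρ pos wait) : Monotone (clock ρ pos wait) := by
  refine Fin.monotone_iff_le_succ.2 fun j => ?_
  by_cases hj : w j = RegionLetter.tau
  · exact (h.clock_tau hj).le
  · exact (h.clock_ne_tau hj).ge

theorem clock_at (h : r.Tracks ρ pos wait) {j : Fin m} {k : Fin n} (hj : ActAt pos j k) :
    clock ρ pos wait j.castSucc = ρ.time k.castSucc := by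
  obtain ⟨a, x, hw⟩ := isAct_iff.1 (h.isAct_of_actAt hj)
  obtain ⟨k', h1, h2, ha, h3, -⟩ := h.act j a x hw
  obtain rfl : k = k' := hj.unique ⟨h1, h2⟩
  rw [clock, h1, h3]
  ring

/-- The clock is monotone and increases exactly at the letters `tau`. -/
theorem time_eq_iff (h : r.Tracks ρ pos wait) {j j' : Fin m} {k k' : Fin n} (hj : ActAt pos j k)
    (hj' : ActAt pos j' k') (hlt : j < j') :
    ρ.time k.castSucc = ρ.time k'.castSucc ↔
      ∀ i, j < i → i < j' → w i ≠ RegionLetter.tau := by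
  rw [← h.clock_at hj, ← h.clock_at hj']
  constructor
  · intro heq i h1 h2 hw
    have h3 := h.clock_mono (Fin.castSucc_le_castSucc_iff.2 h1.le)
    have h4 := h.clock_mono (Fin.succ_le_castSucc_iff.2 h2)
    linarith [h.clock_tau hw]
  · intro hno
    have hne : ∀ i, j ≤ i → i < j' → w i ≠ RegionLetter.tau := by
      intro i h1 h2
      rcases h1.lt_or_eq with h1 | rfl
      · exact hno i h1 h2
      · exact fun hw => h.isAct_of_actAt hj (Or.inl hw)
    have : ∀ b : Fin (m + 1), j.castSucc ≤ b → b ≤ j'.castSucc →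
        clock ρ pos wait j.castSucc = clock ρ pos wait b := by
      intro b
      induction b using Fin.induction with
      | zero => intro h1 _; rw [Fin.le_zero_iff.1 h1]
      | succ b ih =>
        intro h1 h2
        rcases h1.lt_or_eq with h1 | h1
        · have h3 := Fin.castSucc_lt_succ_iff.1 h1
          have h4 := Fin.succ_le_castSucc_iff.1 h2
          rw [h.clock_ne_tau (hne b h3 h4)]
          exact ih (Fin.castSucc_le_castSucc_iff.2 h3) (Fin.castSucc_le_castSucc_iff.2 h4.le)
        · rw [h1]
    exact this _ (Fin.castSucc_le_castSucc_iff.2 hlt.le) le_rfl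

/-! Timers -/

/-- A timeout can only restart its own timer, so `Updates` need not mention timeouts of other
timers. -/
theorem updates_iff (h : r.Tracks ρ pos wait) {j : Fin m} {k : Fin n} (hj : ActAt pos j k)
    {x : X} : (w j).Updates x ↔ ∃ c, ρ.upd k = some (x, c) := by
  rw [h.letter_at hj]
  constructor
  · intro hu
    have : (ρ.upd k).map Prod.fst = some x := by
      rcases hu with ⟨i, hu⟩ | hu
      · exact (RegionLetter.act.inj hu).2
      · exact (RegionLetter.act.inj hu).2
    obtain ⟨⟨y, c⟩, h1, rfl⟩ := Option.map_eq_some_iff.1 this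
    exact ⟨c, h1⟩
  · rintro ⟨c, hc⟩
    rw [hc]
    have ht := ρ.trans_eq k
    rw [hc] at ht
    rcases ha : ρ.act k with i | y
    · exact Or.inl ⟨i, rfl⟩
    · rw [ha] at ht
      obtain rfl := A.timeout_update _ _ _ _ _ ht
      exact Or.inr rfl

theorem timesOut_iff (h : r.Tracks ρ pos wait) {j : Fin m} {k : Fin n} (hj : ActAt pos j k)
    {x : X} : (w j).TimesOut x ↔ ρ.act k = TAction.timeout x := by
  have hl := h.letter_at hj
  constructor
  · rw [hl]
    rintro (hu | hu)
    · exact (RegionLetter.act.inj hu).1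
    · exact (RegionLetter.act.inj hu).1
  · intro ha
    rcases hu : ρ.upd k with _ | ⟨y, c⟩
    · exact Or.inl (by rw [hl, ha, hu]; rfl)
    · have ht := ρ.trans_eq k
      rw [hu, ha] at ht
      obtain rfl := A.timeout_update _ _ _ _ _ ht
      exact Or.inr (by rw [hl, ha, hu]; rfl)

theorem lastUpdate_iff (h : r.Tracks ρ pos wait) {j j' : Fin m} {k k' : Fin n}
    (hj : ActAt pos j k) (hj' : ActAt pos j' k') {x : X} :
    (∃ c, ρ.LastUpdate k'.castSucc x k c) ↔
      j < j' ∧ (w j).Updates x ∧ ∀ i, j < i → i < j' → ¬ (w i).Updates x := by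
  rw [h.lt_iff hj hj', h.updates_iff hj]
  constructor
  · rintro ⟨c, h1, h2, h3⟩
    refine ⟨Fin.castSucc_lt_castSucc_iff.1 h1, ⟨c, h2⟩, fun i h4 h5 h6 => ?_⟩
    obtain ⟨l, hl⟩ := h.exists_actAt h6.isAct
    obtain ⟨c', hc'⟩ := (h.updates_iff hl).1 h6
    exact h3 l (h.lt_of_lt hj hl h4) (Fin.castSucc_lt_castSucc_iff.2 (h.lt_of_lt hl hj' h5)) c' hc'
  · rintro ⟨h1, ⟨c, h2⟩, h3⟩
    refine ⟨c, Fin.castSucc_lt_castSucc_iff.2 h1, h2, fun l h4 h5 c' hc' => ?_⟩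
    obtain ⟨i, hi⟩ := h.actAt_surjective l
    exact h3 i ((h.lt_iff hj hi).2 h4) ((h.lt_iff hi hj').2 (Fin.castSucc_lt_castSucc_iff.1 h5))
      ((h.updates_iff hi).2 ⟨c', hc'⟩)

theorem triggers_iff (h : r.Tracks ρ pos wait) {j j' : Fin m} {k k' : Fin n}
    (hj : ActAt pos j k) (hj' : ActAt pos j' k') :
    ρ.Triggers k k' ↔ j < j' ∧ ∃ x, (w j).Updates x ∧ (w j').TimesOut x ∧
      ∀ i, j < i → i < j' → ¬ (w i).Updates x := by
  rw [ρ.triggers_iff]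
  constructor
  · rintro ⟨x, c, h1, h2⟩
    obtain ⟨h3, h4, h5⟩ := (h.lastUpdate_iff hj hj').1 ⟨c, h1⟩
    exact ⟨h3, x, h4, (h.timesOut_iff hj').2 h2, h5⟩
  · rintro ⟨h1, x, h2, h3, h4⟩
    obtain ⟨c, hc⟩ := (h.lastUpdate_iff hj hj').2 ⟨h1, h2, h4⟩
    exact ⟨x, c, hc, (h.timesOut_iff hj').1 h3⟩

/-- While a timer is pending only `kill` letters can be read. Nothing is pending at the end, so each
pending timer is killed in the stretch of `kill` letters right after its action. Conversely these
letters only shrink the pending set, so what they kill was pending from the start. -/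
theorem discarded_iff (h : r.Tracks ρ pos wait) (hend : (r.state (Fin.last m)).pending = ∅)
    {j : Fin m} {k : Fin n} (hj : ActAt pos j k) {x : X} :
    (ρ.DiscardsAt k x ∧ (ρ.post k.castSucc).val x = some 0) ↔
      ∃ s, j < s ∧ w s = RegionLetter.kill x ∧
        ∀ i, j < i → i < s → ∃ y, w i = RegionLetter.kill y := by
  have hp := h.pending_at hj
  have hx : (ρ.DiscardsAt k x ∧ (ρ.post k.castSucc).val x = some 0) ↔
      x ∈ (r.state j.succ).pending := by rw [hp]; rfl
  rw [hx]
  constructor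
  · intro hmem
    by_contra hno
    have : ∀ b : Fin (m + 1), j.succ ≤ b → x ∈ (r.state b).pending ∧
        ∀ i, j < i → i.castSucc < b → ∃ y, w i = RegionLetter.kill y := by
      intro b
      induction b using Fin.induction with
      | zero => intro h1; exact absurd (Fin.le_zero_iff.1 h1) (Fin.succ_ne_zero j)
      | succ b ih =>
        intro h1
        rcases h1.lt_or_eq with h1 | h1
        · have hjb : j < b := Fin.succ_lt_succ_iff.1 h1
          obtain ⟨h2, h3⟩ := ih (Fin.succ_le_castSucc_iff.2 hjb)
          have hstep := r.step b
          cases hw : w b with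
          | tau => rw [hw] at hstep; rw [hstep.1] at h2; exact absurd h2 (Set.notMem_empty x)
          | act a z => rw [hw] at hstep; rw [hstep.1] at h2; exact absurd h2 (Set.notMem_empty x)
          | kill z =>
            rw [hw] at hstep
            have hxz : x ≠ z := by
              rintro rfl
              exact hno ⟨b, hjb, hw, fun i h4 h5 => h3 i h4 (Fin.castSucc_lt_castSucc_iff.2 h5)⟩
            refine ⟨by rw [hstep.2.2]; exact ⟨h2, hxz⟩, fun i h4 h5 => ?_⟩
            rcases (Fin.castSucc_lt_succ_iff.1 h5).lt_or_eq with h5 | h5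
            · exact h3 i h4 (Fin.castSucc_lt_castSucc_iff.2 h5)
            · exact ⟨z, h5 ▸ hw⟩
        · rw [← h1]
          exact ⟨hmem, fun i h2 h3 => absurd h2 (Fin.castSucc_lt_succ_iff.1 h3).not_gt⟩
    have := (this (Fin.last m) (Fin.le_last _)).1
    rw [hend] at this
    exact this
  · rintro ⟨s, hs, hw, hk⟩
    have : ∀ b : Fin (m + 1), j.succ ≤ b → b ≤ s.castSucc →
        (r.state b).pending ⊆ (r.state j.succ).pending := by
      intro b
      induction b using Fin.induction with
      | zero => intro h1; exact absurd (Fin.le_zero_iff.1 h1) (Fin.succ_ne_zero j)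
      | succ b ih =>
        intro h1 h2
        rcases h1.lt_or_eq with h1 | h1
        · have hjb : j < b := Fin.succ_lt_succ_iff.1 h1
          have hbs : b < s := Fin.succ_le_castSucc_iff.1 h2
          obtain ⟨y, hy⟩ := hk b hjb hbs
          have hstep := r.step b
          rw [hy] at hstep
          rw [hstep.2.2]
          exact Set.sdiff_subset.trans
            (ih (Fin.succ_le_castSucc_iff.2 hjb) (Fin.castSucc_le_castSucc_iff.2 hbs.le))
        · rw [h1]
    have hstep := r.step s
    rw [hw] at hstep
    exact this s.castSucc (Fin.succ_le_castSucc_iff.2 hs) le_rfl hstep.1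

theorem edge_iff (h : r.Tracks ρ pos wait) (hend : (r.state (Fin.last m)).pending = ∅)
    {j j' : Fin m} {k k' : Fin n} (hj : ActAt pos j k) (hj' : ActAt pos j' k') :
    ρ.Edge k k' ↔ (j < j' ∧ ∀ i, j < i → i < j' → w i ≠ RegionLetter.tau) ∨
      (j' < j ∧ ∃ s, j < s ∧ (∀ i, j < i → i < s → ∃ y, w i = RegionLetter.kill y) ∧
        ∃ x, (w j').Updates x ∧ w s = RegionLetter.kill x ∧
          ∀ i, j' < i → i < j → ¬ (w i).Updates x) := by
  refine or_congr ?_ ?_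
  · rw [h.lt_iff hj hj']
    refine and_congr_right fun hlt => ?_
    exact h.time_eq_iff hj hj' ((h.lt_iff hj hj').2 hlt)
  · constructor
    · rintro ⟨x, c, h1, h2⟩
      obtain ⟨h3, h4, h5⟩ := (h.lastUpdate_iff hj' hj).1 ⟨c, h1⟩
      obtain ⟨s, h6, h7, h8⟩ := (h.discarded_iff hend hj).1 h2
      exact ⟨h3, s, h6, h8, x, h4, h7, h5⟩
    · rintro ⟨h3, s, h6, h8, x, h4, h7, h5⟩
      obtain ⟨c, hc⟩ := (h.lastUpdate_iff hj' hj).2 ⟨h3, h4, h5⟩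
      exact ⟨x, c, hc, (h.discarded_iff hend hj).2 ⟨s, h6, h7, h8⟩⟩

end Tracks

end RegionRun

end TimerAutomaton

/-! ### The quantifier-free matrix -/

section RaceMatrix

open RegionLetter

variable {X I : Type*} {m : ℕ}

/-- The quantifier-free part of: the action `p` triggers the action `q`. The position `r` is
universally quantified. -/
def TriggerAt (w : Fin m → RegionLetter X I) (p q r : Fin m) : Prop :=
  p < q ∧ ∃ x, (w p).Updates x ∧ (w q).TimesOut x ∧ (p < r → r < q → ¬ (w r).Updates x)

/-- The quantifier-free part of: there is an edge from the action `p` to the action `q`. The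
position `s` is existentially and `r` is universally quantified. -/
def EdgeAt (w : Fin m → RegionLetter X I) (p q s r : Fin m) : Prop :=
  (p < q ∧ (p < r → r < q → w r ≠ tau)) ∨
  (q < p ∧ p < s ∧ (p < r → r < s → ∃ y, w r = kill y) ∧
    ∃ x, (w q).Updates x ∧ w s = kill x ∧ (q < r → r < p → ¬ (w r).Updates x))

/-- The quantifier-free part of the formula: the word starts at `f` and ends at `l` with a delay,
the set `E ∪ L ∪ R` of actions is not empty, each action in `E` has an edge to this set, and each
action in `L` (in `R`) leads to an action in `E` by triggering (by being triggered). -/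
def CycleAt (w : Fin m → RegionLetter X I) (E L R : Set (Fin m)) (f l p₀ p q s r : Fin m) : Prop :=
  (w f = tau ∧ ¬ r < f) ∧ (w l = tau ∧ ¬ l < r) ∧ (p₀ ∈ E ∨ p₀ ∈ L ∨ p₀ ∈ R) ∧
  (p ∈ L → TriggerAt w p q r ∧ (q ∈ L ∨ q ∈ E)) ∧
  (p ∈ R → TriggerAt w q p r ∧ (q ∈ R ∨ q ∈ E)) ∧
  (p ∈ E → (w p).IsAct ∧ (w q).IsAct ∧ (q ∈ E ∨ q ∈ L ∨ q ∈ R) ∧ EdgeAt w p q s r)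

/-- The universal `r` stands outside the disjunction over timers. It can be moved inside because the
letter at `p` updates only one timer, so the witness does not depend on `r`. -/
theorem forall_triggerAt {w : Fin m → RegionLetter X I} {p q : Fin m} :
    (∀ r, TriggerAt w p q r) ↔ p < q ∧ ∃ x, (w p).Updates x ∧ (w q).TimesOut x ∧
      ∀ i, p < i → i < q → ¬ (w i).Updates x := by
  constructor
  · intro h
    obtain ⟨h1, x, h2, h3, -⟩ := h p
    refine ⟨h1, x, h2, h3, fun i h4 h5 => ?_⟩
    obtain ⟨-, y, h6, -, h7⟩ := h i
    obtain rfl := h2.unique h6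
    exact h7 h4 h5
  · rintro ⟨h1, x, h2, h3, h4⟩ r
    exact ⟨h1, x, h2, h3, h4 r⟩

/-- Again the universal quantifier passes the disjunctions: the order of `p` and `q` selects the
case, and the letter at `q` determines the timer. -/
theorem forall_edgeAt {w : Fin m → RegionLetter X I} {p q s : Fin m} :
    (∀ r, EdgeAt w p q s r) ↔ (p < q ∧ ∀ i, p < i → i < q → w i ≠ tau) ∨
      (q < p ∧ p < s ∧ (∀ i, p < i → i < s → ∃ y, w i = kill y) ∧
        ∃ x, (w q).Updates x ∧ w s = kill x ∧ ∀ i, q < i → i < p → ¬ (w i).Updates x) := by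
  constructor
  · intro h
    rcases h p with ⟨h1, -⟩ | ⟨h1, h2, -, x, h3, h4, -⟩
    · refine Or.inl ⟨h1, fun i => ?_⟩
      rcases h i with ⟨-, h2⟩ | ⟨h2, -⟩
      · exact h2
      · exact absurd h1 h2.asymm
    · refine Or.inr ⟨h1, h2, fun i => ?_, x, h3, h4, fun i => ?_⟩ <;>
        rcases h i with ⟨h5, -⟩ | ⟨-, -, h5, y, h6, -, h7⟩
      · exact absurd h1 h5.asymm
      · exact h5
      · exact absurd h1 h5.asymm
      · obtain rfl := h3.unique h6
        exact h7
  · rintro (⟨h1, h2⟩ | ⟨h1, h2, h3, x, h4, h5, h6⟩) r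
    · exact Or.inl ⟨h1, h2 r⟩
    · exact Or.inr ⟨h1, h2, h3 r, x, h4, h5, h6 r⟩

end RaceMatrix

/-! ### Cycles of the run and models of the matrix -/

namespace TimerAutomaton

variable {X I Q : Type*} {A : TimerAutomaton X I Q}

namespace RegionRun

open RegionLetter TimedRun Relation

variable {m n : ℕ} {w : Fin m → RegionLetter X I} {r : RegionRun A w} {ρ : TimedRun A n}
  {pos : Fin (m + 1) → Fin (n + 1)} {wait : Fin (m + 1) → ℝ}

namespace Tracks

/-- From the set `S` of a cycle, E consists of the actions with an edge into `S`, and every element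
of `S` is in E or linked to E by triggering in one of the two directions. -/
theorem exists_cycleAt (h : r.Tracks ρ pos wait) (hend : (r.state (Fin.last m)).pending = ∅)
    (h0 : 0 < ρ.delay 0) (h1 : 0 < ρ.delay (Fin.last n)) (hc : ρ.Cyclic) :
    ∃ E L R f l p₀, ∀ p, ∃ q s, ∀ i, CycleAt w E L R f l p₀ p q s i := by
  obtain ⟨f, hf, hwf⟩ := h.first_delay_pos.1 h0
  obtain ⟨l, hl, hwl⟩ := h.last_delay_pos.1 h1
  obtain ⟨S, ⟨k₀, hk₀⟩, hS⟩ := hc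
  let T : Set (Fin n) := {k | ∃ p ∈ S, ρ.SameBlock p k}
  let E : Set (Fin n) := {k | ∃ q ∈ S, ρ.Edge k q}
  -- E, L and R are disjoint by construction: the matrix has one pair of witnesses `q`, `s` for each
  -- `p`, so at most one of its three implications may be active.
  let L : Set (Fin n) := {k | k ∉ E ∧ ∃ e ∈ E, TransGen ρ.Triggers k e}
  let R : Set (Fin n) := {k | k ∉ E ∧ k ∉ L ∧ ∃ e ∈ E, TransGen ρ.Triggers e k}
  have hcover : ∀ k ∈ S, k ∈ E ∨ k ∈ L ∨ k ∈ R := by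
    intro k hk
    by_cases hkE : k ∈ E
    · exact Or.inl hkE
    by_cases hkL : k ∈ L
    · exact Or.inr (Or.inl hkL)
    obtain ⟨e, q, hb, he, hq⟩ := hS k hk
    have heE : e ∈ E := ⟨q, hq, he⟩
    have hne : e ≠ k := fun h => hkE (h ▸ heE)
    rcases hb with hb | hb <;> rcases reflTransGen_iff_eq_or_transGen.1 hb with hb | hb
    · exact absurd hb hne
    · exact absurd ⟨hkE, e, heE, hb⟩ hkL
    · exact absurd hb.symm hne
    · exact Or.inr (Or.inr ⟨hkE, hkL, e, heE, hb⟩)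
  have hL : ∀ k ∈ L, ∃ k', ρ.Triggers k k' ∧ (k' ∈ L ∨ k' ∈ E) := by
    rintro k ⟨-, e, he, ht⟩
    obtain ⟨k', h2, h3⟩ := TransGen.head'_iff.1 ht
    refine ⟨k', h2, ?_⟩
    by_cases hk' : k' ∈ E
    · exact Or.inr hk'
    · rcases reflTransGen_iff_eq_or_transGen.1 h3 with h3 | h3
      · exact absurd (h3 ▸ he) hk'
      · exact Or.inl ⟨hk', e, he, h3⟩
  have hR : ∀ k ∈ R, ∃ k', ρ.Triggers k' k ∧ (k' ∈ R ∨ k' ∈ E) := by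
    rintro k ⟨hkE, hkL, e, he, ht⟩
    obtain ⟨k', h3, h2⟩ := TransGen.tail'_iff.1 ht
    refine ⟨k', h2, ?_⟩
    by_cases hk' : k' ∈ E
    · exact Or.inr hk'
    · rcases reflTransGen_iff_eq_or_transGen.1 h3 with h3 | h3
      · exact absurd (h3 ▸ he) hk'
      · refine Or.inl ⟨hk', ?_, e, he, h3⟩
        -- If the predecessor were in L, its path to E would pass through `k`, its only successor,
        -- which would put `k` in E or L.
        rintro ⟨-, e', he', ht'⟩
        obtain ⟨k'', h4, h5⟩ := TransGen.head'_iff.1 ht'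
        obtain rfl := h2.right_unique h4
        rcases reflTransGen_iff_eq_or_transGen.1 h5 with h5 | h5
        · exact hkE (h5 ▸ he')
        · exact hkL ⟨hkE, e', he', h5⟩
  let lift : Set (Fin n) → Set (Fin m) := fun U => {j | ∃ k ∈ U, ActAt pos j k}
  have hlift : ∀ (U : Set (Fin n)) {j k}, ActAt pos j k → (j ∈ lift U ↔ k ∈ U) := by
    intro U j k hj
    refine ⟨?_, fun hk => ⟨k, hk, hj⟩⟩
    rintro ⟨k', hk', hj'⟩
    rwa [hj.unique hj']
  obtain ⟨p₀, hp₀⟩ := h.actAt_surjective k₀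
  refine ⟨lift E, lift L, lift R, f, l, p₀, fun p => ?_⟩
  have hbase : ∀ i, (w f = RegionLetter.tau ∧ ¬ i < f) ∧ (w l = RegionLetter.tau ∧ ¬ l < i) ∧
      (p₀ ∈ lift E ∨ p₀ ∈ lift L ∨ p₀ ∈ lift R) := by
    intro i
    refine ⟨⟨hwf, hf i⟩, ⟨hwl, hl i⟩, ?_⟩
    simpa only [hlift _ hp₀] using hcover k₀ hk₀
  suffices hs : ∃ q s, (p ∈ lift L → (∀ i, TriggerAt w p q i) ∧ (q ∈ lift L ∨ q ∈ lift E)) ∧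
      (p ∈ lift R → (∀ i, TriggerAt w q p i) ∧ (q ∈ lift R ∨ q ∈ lift E)) ∧
      (p ∈ lift E → (w p).IsAct ∧ (w q).IsAct ∧ (q ∈ lift E ∨ q ∈ lift L ∨ q ∈ lift R) ∧
        ∀ i, EdgeAt w p q s i) by
    obtain ⟨q, s, h2, h3, h4⟩ := hs
    exact ⟨q, s, fun i => ⟨(hbase i).1, (hbase i).2.1, (hbase i).2.2,
      fun h5 => ⟨(h2 h5).1 i, (h2 h5).2⟩, fun h5 => ⟨(h3 h5).1 i, (h3 h5).2⟩,
      fun h5 => ⟨(h4 h5).1, (h4 h5).2.1, (h4 h5).2.2.1, (h4 h5).2.2.2 i⟩⟩⟩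
  by_cases hp : ∃ k, ActAt pos p k
  swap
  · have hno : ∀ U, p ∉ lift U := fun U hU => hp ⟨_, hU.choose_spec.2⟩
    exact ⟨p, p, fun h2 => absurd h2 (hno _), fun h2 => absurd h2 (hno _),
      fun h2 => absurd h2 (hno _)⟩
  obtain ⟨k, hk⟩ := hp
  simp only [hlift _ hk]
  by_cases hkE : k ∈ E
  · obtain ⟨k', hk'S, he⟩ := hkE
    obtain ⟨q, hq⟩ := h.actAt_surjective k'
    have hkE' : k ∈ E := ⟨k', hk'S, he⟩
    have hcov := hcover k' hk'S
    simp only [← hlift _ hq] at hcov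
    obtain ⟨s, hs⟩ : ∃ s, ∀ i, EdgeAt w p q s i := by
      simp only [forall_edgeAt]
      rcases (h.edge_iff hend hk hq).1 he with h2 | ⟨h2, s, h3⟩
      · exact ⟨p, Or.inl h2⟩
      · exact ⟨s, Or.inr ⟨h2, h3⟩⟩
    exact ⟨q, s, fun h2 => absurd hkE' h2.1, fun h2 => absurd hkE' h2.1, fun _ =>
      ⟨h.isAct_of_actAt hk, h.isAct_of_actAt hq, hcov, hs⟩⟩
  by_cases hkL : k ∈ L
  · obtain ⟨k', h2, h3⟩ := hL k hkL
    obtain ⟨q, hq⟩ := h.actAt_surjective k'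
    simp only [← hlift _ hq] at h3
    exact ⟨q, p, fun _ => ⟨forall_triggerAt.2 ((h.triggers_iff hk hq).1 h2), h3⟩,
      fun h4 => absurd hkL h4.2.1, fun h4 => absurd h4 hkE⟩
  by_cases hkR : k ∈ R
  · obtain ⟨k', h2, h3⟩ := hR k hkR
    obtain ⟨q, hq⟩ := h.actAt_surjective k'
    simp only [← hlift _ hq] at h3
    exact ⟨q, p, fun h4 => absurd h4 hkL,
      fun _ => ⟨forall_triggerAt.2 ((h.triggers_iff hq hk).1 h2), h3⟩, fun h4 => absurd h4 hkE⟩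
  exact ⟨p, p, fun h2 => absurd h2 hkL, fun h2 => absurd h2 hkR, fun h2 => absurd h2 hkE⟩

/-- Following the neighbours of an element of L or R must end in E, since positions move strictly
right in L and left in R. So every action of the union shares its block with one in E, which has an
edge back into the union. -/
theorem cyclic_of_cycleAt (h : r.Tracks ρ pos wait) (hend : (r.state (Fin.last m)).pending = ∅)
    {E L R : Set (Fin m)} {f l p₀ : Fin m}
    (hc : ∀ p, ∃ q s, ∀ i, CycleAt w E L R f l p₀ p q s i) :
    0 < ρ.delay 0 ∧ 0 < ρ.delay (Fin.last n) ∧ ρ.Cyclic := by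
  have hbase : ∀ i, (w f = RegionLetter.tau ∧ ¬ i < f) ∧ (w l = RegionLetter.tau ∧ ¬ l < i) ∧
      (p₀ ∈ E ∨ p₀ ∈ L ∨ p₀ ∈ R) := by
    obtain ⟨q, s, h1⟩ := hc p₀
    exact fun i => ⟨(h1 i).1, (h1 i).2.1, (h1 i).2.2.1⟩
  have hL : ∀ p ∈ L, ∃ q, (∀ i, TriggerAt w p q i) ∧ (q ∈ L ∨ q ∈ E) := by
    intro p hp
    obtain ⟨q, s, h1⟩ := hc p
    exact ⟨q, fun i => ((h1 i).2.2.2.1 hp).1, ((h1 p).2.2.2.1 hp).2⟩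
  have hR : ∀ p ∈ R, ∃ q, (∀ i, TriggerAt w q p i) ∧ (q ∈ R ∨ q ∈ E) := by
    intro p hp
    obtain ⟨q, s, h1⟩ := hc p
    exact ⟨q, fun i => ((h1 i).2.2.2.2.1 hp).1, ((h1 p).2.2.2.2.1 hp).2⟩
  have hE : ∀ p ∈ E, ∃ q s, (w p).IsAct ∧ (w q).IsAct ∧ (q ∈ E ∨ q ∈ L ∨ q ∈ R) ∧
      ∀ i, EdgeAt w p q s i := by
    intro p hp
    obtain ⟨q, s, h1⟩ := hc p
    have h2 := (h1 p).2.2.2.2.2 hp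
    exact ⟨q, s, h2.1, h2.2.1, h2.2.2.1, fun i => ((h1 i).2.2.2.2.2 hp).2.2.2⟩
  have hEk : ∀ p ∈ E, ∃ k, ActAt pos p k := fun p hp => by
    obtain ⟨q, s, h1, -⟩ := hE p hp
    exact h.exists_actAt h1
  have hL' : ∀ p ∈ L, ∃ k e k', ActAt pos p k ∧ e ∈ E ∧ ActAt pos e k' ∧
      ReflTransGen ρ.Triggers k k' := by
    intro p
    -- Triggering leads to the right, so the induction runs down from the end of the word.
    induction p using WellFoundedGT.induction with
    | ind p ih =>
      intro hp
      obtain ⟨q, h1, h2⟩ := hL p hp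
      have h3 := forall_triggerAt.1 h1
      obtain ⟨h4, x, h5, h6, -⟩ := id h3
      obtain ⟨k, hk⟩ := h.exists_actAt h5.isAct
      obtain ⟨k₁, hk₁⟩ := h.exists_actAt h6.isAct
      have ht := (h.triggers_iff hk hk₁).2 h3
      rcases h2 with h2 | h2
      · obtain ⟨k₂, e, k', h7, h8, h9, h10⟩ := ih q h4 h2
        obtain rfl := hk₁.unique h7
        exact ⟨k, e, k', hk, h8, h9, .head ht h10⟩
      · exact ⟨k, q, k₁, hk, h2, hk₁, .single ht⟩
  have hR' : ∀ p ∈ R, ∃ k e k', ActAt pos p k ∧ e ∈ E ∧ ActAt pos e k' ∧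
      ReflTransGen ρ.Triggers k' k := by
    intro p
    induction p using WellFoundedLT.induction with
    | ind p ih =>
      intro hp
      obtain ⟨q, h1, h2⟩ := hR p hp
      have h3 := forall_triggerAt.1 h1
      obtain ⟨h4, x, h5, h6, -⟩ := id h3
      obtain ⟨k₁, hk₁⟩ := h.exists_actAt h5.isAct
      obtain ⟨k, hk⟩ := h.exists_actAt h6.isAct
      have ht := (h.triggers_iff hk₁ hk).2 h3
      rcases h2 with h2 | h2
      · obtain ⟨k₂, e, k', h7, h8, h9, h10⟩ := ih q h4 h2
        obtain rfl := hk₁.unique h7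
        exact ⟨k, e, k', hk, h8, h9, .tail h10 ht⟩
      · exact ⟨k, q, k₁, hk, h2, hk₁, .single ht⟩
  have hall : ∀ p, (p ∈ E ∨ p ∈ L ∨ p ∈ R) → ∃ k e k', ActAt pos p k ∧ e ∈ E ∧ ActAt pos e k' ∧
      ρ.SameBlock k k' := by
    rintro p (hp | hp | hp)
    · obtain ⟨k, hk⟩ := hEk p hp
      exact ⟨k, p, k, hk, hp, hk, SameBlock.refl _ _⟩
    · obtain ⟨k, e, k', h1, h2, h3, h4⟩ := hL' p hp
      exact ⟨k, e, k', h1, h2, h3, Or.inl h4⟩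
    · obtain ⟨k, e, k', h1, h2, h3, h4⟩ := hR' p hp
      exact ⟨k, e, k', h1, h2, h3, Or.inr h4⟩
  refine ⟨h.first_delay_pos.2 ⟨f, fun i => (hbase i).1.2, (hbase f).1.1⟩,
    h.last_delay_pos.2 ⟨l, fun i => (hbase i).2.1.2, (hbase l).2.1.1⟩,
    {k | ∃ p, ActAt pos p k ∧ (p ∈ E ∨ p ∈ L ∨ p ∈ R)}, ?_, ?_⟩
  · obtain ⟨k, -, -, hk, -⟩ := hall p₀ (hbase p₀).2.2
    exact ⟨k, p₀, hk, (hbase p₀).2.2⟩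
  · rintro k ⟨p, hk, hp⟩
    obtain ⟨k₁, e, k', hk₁, he, hk', hs⟩ := hall p hp
    obtain rfl := hk.unique hk₁
    obtain ⟨q, s, -, h2, h3, h4⟩ := hE e he
    obtain ⟨kq, hkq⟩ := h.exists_actAt h2
    refine ⟨k', kq, hs, (h.edge_iff hend hk' hkq).2 ?_, q, hkq, h3⟩
    rcases forall_edgeAt.1 h4 with h5 | ⟨h5, h6⟩
    · exact Or.inl h5
    · exact Or.inr ⟨h5, s, h6⟩

end Tracks

/-- A region run represents a timed run if its last letter is a delay. -/
theorem exists_represents [Finite X] (r : RegionRun A w) {l : Fin m} (hl : ∀ i, ¬ l < i)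
    (hw : w l = RegionLetter.tau) : ∃ (n : ℕ) (ρ : TimedRun A n), r.Represents ρ := by
  obtain ⟨n, ρ, pos, wait, h⟩ := r.exists_tracks
  refine ⟨n, ρ, represents_iff.2 ⟨⟨pos, wait, h⟩, ?_⟩⟩
  have hstep := r.step l
  rw [hw] at hstep
  have hl' : l.succ = Fin.last m := by
    rcases m with _ | m
    · exact l.elim0
    · rw [← Fin.succ_last, Fin.succ_inj]
      exact le_antisymm (Fin.le_last _) (not_lt.1 (hl (Fin.last m)))
  rw [← hl']
  exact hstep.2.1

theorem exists_cycleAt_of_padded {r : RegionRun A w} (hp : r.Padded) (hw : ¬ r.Wigglable) :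
    ∃ E L R f l p₀, ∀ p, ∃ q s, ∀ i, CycleAt w E L R f l p₀ p q s i := by
  obtain ⟨n, ρ, hr, hρ⟩ := hp
  obtain ⟨⟨pos, wait, h⟩, hend⟩ := represents_iff.1 hr
  refine h.exists_cycleAt hend hρ.1 hρ.2.1 ?_
  by_contra hc
  exact hw ⟨n, ρ, hr, wigglable_of_not_cyclic hρ hc⟩

/-- The matrix speaks only of `w`, so it makes every timed run represented by `r` cyclic, and none
of them can be wiggled. Padding needs the hypothesis on the last state, which the word does not
reveal. -/
theorem padded_of_cycleAt [Finite X] {r : RegionRun A w} (hr : r.NoZeroAtEnd)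
    (hc : ∃ E L R f l p₀, ∀ p, ∃ q s, ∀ i, CycleAt w E L R f l p₀ p q s i) :
    r.Padded ∧ ¬ r.Wigglable := by
  obtain ⟨E, L, R, f, l, p₀, hc⟩ := hc
  have hl : (∀ i, ¬ l < i) ∧ w l = tau := by
    obtain ⟨q, s, h1⟩ := hc p₀
    exact ⟨fun i => (h1 i).2.1.2, (h1 p₀).2.1.1⟩
  constructor
  · obtain ⟨n, ρ, hρ⟩ := r.exists_represents hl.1 hl.2
    obtain ⟨⟨pos, wait, h⟩, hend⟩ := represents_iff.1 hρ
    obtain ⟨h1, h2, -⟩ := h.cyclic_of_cycleAt hend hc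
    refine ⟨n, ρ, hρ, h1, h2, fun x => ?_⟩
    obtain ⟨c, h3, h4⟩ := h.region (Fin.last m)
    rw [h.pos_last, h.wait_last] at h3
    rw [h3.unique (ρ.delay_step _)] at h4
    exact hr _ h4 x
  · rintro ⟨n, ρ, hρ, hw⟩
    obtain ⟨⟨pos, wait, h⟩, hend⟩ := represents_iff.1 hρ
    exact (h.cyclic_of_cycleAt hend hc).2.2.not_wigglable hw

end RegionRun

end TimerAutomaton

/-! ### The MSO sentence and its size -/

namespace MSO

variable {S α : Type*} {k l m : ℕ}

/-- The disjunction of the formulas `g a` for `a` in a list (false if the list is empty). -/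
def disj (p : Fin k) (g : α → MSO S k l) : List α → MSO S k l
  | [] => lt p p
  | a :: t => or (g a) (disj p g t)

theorem sat_disj (w : Fin m → S) (p : Fin k) (g : α → MSO S k l) (t : List α) (v : Fin k → Fin m)
    (V : Fin l → Set (Fin m)) : Sat w (disj p g t) v V ↔ ∃ a ∈ t, Sat w (g a) v V := by
  induction t with
  | nil => simp [disj, Sat]
  | cons a t ih => simp [disj, Sat, ih]

theorem quantFree_disj (p : Fin k) {g : α → MSO S k l} (hg : ∀ a, (g a).QuantFree) (t : List α) :
    (disj p g t).QuantFree := by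
  induction t with
  | nil => simp [disj, QuantFree]
  | cons a t ih => simp [disj, QuantFree, hg, ih]

theorem size_disj (p : Fin k) {g : α → MSO S k l} {b : ℕ} (hg : ∀ a, (g a).size ≤ b) (t : List α) :
    (disj p g t).size ≤ 1 + t.length * (b + 1) := by
  induction t with
  | nil => simp [disj, size]
  | cons a t ih =>
    have := hg a
    simp only [disj, size, List.length_cons]
    linarith

end MSO

namespace RaceFormula

open MSO

variable {X I : Type*} {k l m : ℕ}

/-- The letter at `p` updates the timer `x`. -/
noncomputable def updates [Fintype I] (x : X) (p : Fin k) : MSO (RegionLetter X I) k l :=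
  or (disj p (fun i => letter (RegionLetter.act (TAction.input i) (some x)) p)
    (Finset.univ : Finset I).toList) (letter (RegionLetter.act (TAction.timeout x) (some x)) p)

/-- The letter at `p` is a timeout of `x`. -/
def timesOut (x : X) (p : Fin k) : MSO (RegionLetter X I) k l :=
  or (letter (RegionLetter.act (TAction.timeout x) none) p)
    (letter (RegionLetter.act (TAction.timeout x) (some x)) p)

/-- The letter at `p` is a `kill` symbol. -/
noncomputable def isKill [Fintype X] (p : Fin k) : MSO (RegionLetter X I) k l :=
  disj p (fun x => letter (RegionLetter.kill x) p) (Finset.univ : Finset X).toList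

/-- The letter at `p` is an action. -/
noncomputable def isAct [Fintype X] (p : Fin k) : MSO (RegionLetter X I) k l :=
  not (or (letter RegionLetter.tau p) (isKill p))

/-- The formula for `TriggerAt`. -/
noncomputable def triggerAt [Fintype X] [Fintype I] (p q r : Fin k) : MSO (RegionLetter X I) k l :=
  and (lt p q) (disj p (fun x => and (updates x p) (and (timesOut x q)
    (imp (lt p r) (imp (lt r q) (not (updates x r)))))) (Finset.univ : Finset X).toList)

/-- The formula for `EdgeAt`. -/
noncomputable def edgeAt [Fintype X] [Fintype I] (p q s r : Fin k) : MSO (RegionLetter X I) k l :=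
  or (and (lt p q) (imp (lt p r) (imp (lt r q) (not (letter RegionLetter.tau r)))))
    (and (lt q p) (and (lt p s) (and (imp (lt p r) (imp (lt r s) (isKill r)))
      (disj p (fun x => and (updates x q) (and (letter (RegionLetter.kill x) s)
        (imp (lt q r) (imp (lt r p) (not (updates x r)))))) (Finset.univ : Finset X).toList))))

/-- The formula for `CycleAt`. -/
noncomputable def cycleAt [Fintype X] [Fintype I] (E L R : Fin l) (f e p₀ p q s r : Fin k) :
    MSO (RegionLetter X I) k l :=
  and (and (letter RegionLetter.tau f) (not (lt r f)))
  (and (and (letter RegionLetter.tau e) (not (lt e r)))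
  (and (or (mem p₀ E) (or (mem p₀ L) (mem p₀ R)))
  (and (imp (mem p L) (and (triggerAt p q r) (or (mem q L) (mem q E))))
  (and (imp (mem p R) (and (triggerAt q p r) (or (mem q R) (mem q E))))
  (imp (mem p E) (and (isAct p) (and (isAct q)
    (and (or (mem q E) (or (mem q L) (mem q R))) (edgeAt p q s r)))))))))

/-- The formula that expresses that a run cannot be wiggled. -/
noncomputable def sentence (X I : Type*) [Fintype X] [Fintype I] : MSO (RegionLetter X I) 0 0 :=
  -- Index 0 is the innermost variable, so the arguments list sets and positions from the outermost
  -- quantifier inwards. The prefix is ∃∀∃∀.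
  exSet (exSet (exSet (exPos (exPos (exPos (allPos (exPos (exPos (allPos
    (cycleAt 2 1 0 6 5 4 3 2 1 0))))))))))

variable (w : Fin m → RegionLetter X I) (v : Fin k → Fin m) (V : Fin l → Set (Fin m))

theorem sat_updates [Fintype I] (x : X) (p : Fin k) :
    Sat w (updates x p) v V ↔ (w (v p)).Updates x := by
  simp [updates, Sat, sat_disj, RegionLetter.Updates]

theorem sat_timesOut (x : X) (p : Fin k) : Sat w (timesOut x p) v V ↔ (w (v p)).TimesOut x := by
  simp [timesOut, Sat, RegionLetter.TimesOut]

theorem sat_isKill [Fintype X] (p : Fin k) :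
    Sat w (isKill p) v V ↔ ∃ x, w (v p) = RegionLetter.kill x := by
  simp [isKill, Sat, sat_disj]

theorem sat_isAct [Fintype X] (p : Fin k) : Sat w (isAct p) v V ↔ (w (v p)).IsAct := by
  simp only [isAct, Sat, sat_isKill, RegionLetter.IsAct]

theorem sat_triggerAt [Fintype X] [Fintype I] (p q r : Fin k) :
    Sat w (triggerAt p q r) v V ↔ TriggerAt w (v p) (v q) (v r) := by
  simp only [triggerAt, Sat, sat_disj, sat_updates, sat_timesOut, TriggerAt, Finset.mem_toList,
    Finset.mem_univ, true_and]

theorem sat_edgeAt [Fintype X] [Fintype I] (p q s r : Fin k) :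
    Sat w (edgeAt p q s r) v V ↔ EdgeAt w (v p) (v q) (v s) (v r) := by
  simp only [edgeAt, Sat, sat_disj, sat_updates, sat_isKill, EdgeAt, Finset.mem_toList,
    Finset.mem_univ, true_and, ne_eq]

theorem sat_cycleAt [Fintype X] [Fintype I] (E L R : Fin l) (f e p₀ p q s r : Fin k) :
    Sat w (cycleAt E L R f e p₀ p q s r) v V ↔
      CycleAt w (V E) (V L) (V R) (v f) (v e) (v p₀) (v p) (v q) (v s) (v r) := by
  simp only [cycleAt, Sat, sat_triggerAt, sat_isAct, sat_edgeAt, CycleAt]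

theorem models_sentence [Fintype X] [Fintype I] : Models w (sentence X I) ↔
    ∃ E L R f e p₀, ∀ p, ∃ q s, ∀ r, CycleAt w E L R f e p₀ p q s r := by
  simp only [Models, sentence, Sat, sat_cycleAt]
  rfl

theorem quantFree_updates [Fintype I] (x : X) (p : Fin k) :
    (updates x p : MSO (RegionLetter X I) k l).QuantFree := by
  refine ⟨quantFree_disj _ (fun _ => ?_) _, trivial⟩
  exact trivial

theorem quantFree_timesOut (x : X) (p : Fin k) :
    (timesOut x p : MSO (RegionLetter X I) k l).QuantFree := by
  simp [timesOut, QuantFree]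

theorem quantFree_isKill [Fintype X] (p : Fin k) :
    (isKill p : MSO (RegionLetter X I) k l).QuantFree := by
  refine quantFree_disj _ (fun _ => ?_) _
  exact trivial

theorem quantFree_triggerAt [Fintype X] [Fintype I] (p q r : Fin k) :
    (triggerAt p q r : MSO (RegionLetter X I) k l).QuantFree := by
  refine ⟨trivial, quantFree_disj _ (fun x => ?_) _⟩
  exact ⟨quantFree_updates x p, quantFree_timesOut x q, trivial, trivial, quantFree_updates x r⟩

theorem quantFree_edgeAt [Fintype X] [Fintype I] (p q s r : Fin k) :
    (edgeAt p q s r : MSO (RegionLetter X I) k l).QuantFree := by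
  refine ⟨⟨trivial, trivial, trivial, trivial⟩, trivial, trivial,
    ⟨trivial, trivial, quantFree_isKill r⟩, quantFree_disj _ (fun x => ?_) _⟩
  exact ⟨quantFree_updates x q, trivial, trivial, trivial, quantFree_updates x r⟩

theorem quantFree_cycleAt [Fintype X] [Fintype I] (E L R : Fin l) (f e p₀ p q s r : Fin k) :
    (cycleAt E L R f e p₀ p q s r : MSO (RegionLetter X I) k l).QuantFree := by
  simp only [cycleAt, QuantFree, isAct, quantFree_triggerAt, quantFree_edgeAt, quantFree_isKill,
    and_self]

theorem isPrenex_sentence [Fintype X] [Fintype I] : (sentence X I).IsPrenex :=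
  quantFree_cycleAt 2 1 0 6 5 4 3 2 1 0

theorem alternationCount_sentence [Fintype X] [Fintype I] :
    alternationCount (sentence X I).quantPrefix = 3 := rfl

theorem size_updates [Fintype I] (x : X) (p : Fin k) :
    (updates x p : MSO (RegionLetter X I) k l).size ≤ 2 * Fintype.card I + 3 := by
  have := size_disj (l := l) (b := 1) p
    (g := fun i : I => letter (RegionLetter.act (TAction.input i) (some x)) p)
    (fun i => le_rfl) (Finset.univ : Finset I).toList
  rw [Finset.length_toList, Finset.card_univ] at this
  simp only [updates, size]
  linarith

theorem size_isKill [Fintype X] (p : Fin k) :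
    (isKill p : MSO (RegionLetter X I) k l).size ≤ 2 * Fintype.card X + 1 := by
  have := size_disj (l := l) (b := 1) p
    (g := fun x : X => (letter (RegionLetter.kill x) p : MSO (RegionLetter X I) k l))
    (fun i => le_rfl) (Finset.univ : Finset X).toList
  rw [Finset.length_toList, Finset.card_univ] at this
  simp only [isKill]
  linarith

theorem size_triggerAt [Fintype X] [Fintype I] (p q r : Fin k) :
    (triggerAt p q r : MSO (RegionLetter X I) k l).size ≤
      3 + Fintype.card X * (4 * Fintype.card I + 17) := by
  have h := size_disj (l := l) (b := 4 * Fintype.card I + 16) p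
    (g := fun x : X => (and (updates x p) (and (timesOut x q)
      (imp (lt p r) (imp (lt r q) (not (updates x r))))) : MSO (RegionLetter X I) k l))
    (fun x => by
      have h1 := size_updates (I := I) (l := l) x p
      have h2 := size_updates (I := I) (l := l) x r
      simp only [size, timesOut]
      linarith) (Finset.univ : Finset X).toList
  rw [Finset.length_toList, Finset.card_univ] at h
  simp only [triggerAt, size]
  linarith

theorem size_edgeAt [Fintype X] [Fintype I] (p q s r : Fin k) :
    (edgeAt p q s r : MSO (RegionLetter X I) k l).size ≤
      22 + Fintype.card X * (4 * Fintype.card I + 19) := by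
  have h := size_disj (l := l) (b := 4 * Fintype.card I + 16) p
    (g := fun x : X => (and (updates x q) (and (letter (RegionLetter.kill x) s)
      (imp (lt q r) (imp (lt r p) (not (updates x r))))) : MSO (RegionLetter X I) k l))
    (fun x => by
      have h1 := size_updates (I := I) (l := l) x q
      have h2 := size_updates (I := I) (l := l) x r
      simp only [size]
      linarith) (Finset.univ : Finset X).toList
  rw [Finset.length_toList, Finset.card_univ] at h
  have h3 := size_isKill (X := X) (I := I) (l := l) r
  simp only [edgeAt, size]
  linarith

/-- Only `updates` ranges over inputs, and it occurs inside disjunctions over timers that are not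
nested, so the size is bilinear. The bounds add up to 12|I||X| + 57|X| + 86. -/
theorem size_sentence [Fintype X] [Fintype I] :
    (sentence X I).size ≤ 150 * (Fintype.card I + 1) * (Fintype.card X + 1) := by
  have h1 := size_triggerAt (X := X) (I := I) (k := 7) (l := 3) 3 2 0
  have h2 := size_triggerAt (X := X) (I := I) (k := 7) (l := 3) 2 3 0
  have h3 := size_edgeAt (X := X) (I := I) (k := 7) (l := 3) 3 2 1 0
  have h4 := size_isKill (X := X) (I := I) (k := 7) (l := 3) 3
  have h5 := size_isKill (X := X) (I := I) (k := 7) (l := 3) 2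
  simp only [sentence, cycleAt, isAct, size]
  linarith [Nat.zero_le (Fintype.card I * Fintype.card X), Nat.zero_le (Fintype.card I),
    Nat.zero_le (Fintype.card X)]

end RaceFormula

theorem mainTheorem5 :
    ∃ C : ℕ, ∀ (X : Type*) (I : Type*) [Fintype X] [Fintype I],
      ∃ Φ : MSO (RegionLetter X I) 0 0,
        Φ.size ≤ C * (Fintype.card I + 1) * (Fintype.card X + 1) ∧
        Φ.IsPrenex ∧ alternationCount Φ.quantPrefix = 3 ∧
        ∀ (Q : Type*) [Finite Q] (A : TimerAutomaton X I Q)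
          (m : ℕ) (w : Fin m → RegionLetter X I) (r : A.RegionRun w),
          (MSO.Models w Φ ↔ ∃ r' : A.RegionRun w, r'.Padded ∧ ¬ r'.Wigglable) ∧
          (r.NoZeroAtEnd → (MSO.Models w Φ ↔ r.Padded ∧ ¬ r.Wigglable)) := by
  refine ⟨150, fun X I _ _ => ⟨RaceFormula.sentence X I, RaceFormula.size_sentence,
    RaceFormula.isPrenex_sentence, RaceFormula.alternationCount_sentence, ?_⟩⟩
  intro Q _ A m w r
  rw [RaceFormula.models_sentence]
  refine ⟨⟨fun h => ?_, fun ⟨r', h1, h2⟩ =>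
    TimerAutomaton.RegionRun.exists_cycleAt_of_padded h1 h2⟩, fun hr =>
    ⟨TimerAutomaton.RegionRun.padded_of_cycleAt hr, fun ⟨h1, h2⟩ =>
      TimerAutomaton.RegionRun.exists_cycleAt_of_padded h1 h2⟩⟩
  -- The given run may end with a timer at zero. The formula forces the last letter to be `tau`, so
  -- another run with the same label avoids this.
  obtain ⟨r', hr'⟩ : ∃ r' : A.RegionRun w, r'.NoZeroAtEnd := by
    obtain ⟨E, L, R, f, l, p₀, hc⟩ := id h
    obtain ⟨q, s, h1⟩ := hc p₀
    rcases m with _ | m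
    · exact l.elim0
    · refine r.exists_noZeroAtEnd ?_
      rw [← (h1 p₀).2.1.1]
      congr 1
      exact le_antisymm (not_lt.1 (h1 (Fin.last m)).2.1.2) (Fin.le_last _)
  exact ⟨r', TimerAutomaton.RegionRun.padded_of_cycleAt hr' h⟩
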